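/- **Definitions.** A *closed folded ribbon* of width $w>0$ and length $L>0$ is a strip $[0,L]\times[-w/2,w/2]$ whose ends are glued to form an annulus or a Möbius band, mapped into the Euclidean plane by folding it flat along finitely many straight creases. The creases run from one edge of the strip to the other, cross the centre line, and do not meet except possibly on the edges of the strip. The map is an isometry on each panel between consecutive creases and turns the ribbon over at every crease. The length $L$ is measured along the centre line. The folded ribbon is *tied as* a knot $K\subset\mathbb R^3$ if there is a continuous height function on the ribbon without its edges such that the map (position in the plane, height) embeds the ribbon without its edges in $\mathbb R^3$, and the image of the centre line is ambient isotopic to $K$. It *forms a regular $n$-gon* if it has exactly $n$ creases, their images are exactly the sides of a regular $n$-gon, and the ribbon lies in that polygon (a hole around the centre is allowed). The (closed) *Ribbonlength* of $K$ is the infimum of $L/w$ over all closed folded ribbons tied as $K$. The $(p,q)$ torus knot (for coprime $p,q\ge 1$) is the curve $$t\mapsto\bigl((2+\cos pt)\cos qt,\ (2+\cos pt)\sin qt,\ -\sin pt\bigr).$$ **Statement.** Let $q\ge 3$ be odd and let $n=2q+2$ or $n=2q+4$. Then there is a closed folded ribbon that is tied as the $(n,q)$ torus knot, forms a regular $n$-gon,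 and has length-to-width ratio $$\frac{L}{w}=n\cot\frac{\pi}{n}.$$ In particular, the Ribbonlength of the $(n,q)$ torus knot is at most $n\cot(\pi/n)$. -/

import Mathlib

/-- Euclidean three-space, as the product of the plane `ℂ` and the vertical axis `ℝ`. -/
abbrev Space3 : Type := ℂ × ℝ

/-- Two subsets of three-space are ambient isotopic: some isotopy of the whole space, through
homeomorphisms and starting at the identity, carries the first onto the second. -/
def AmbientIsotopic (K K' : Set Space3) : Prop :=
  ∃ H : unitInterval → (Space3 ≃ₜ Space3),
    Continuous (fun p : unitInterval × Space3 => H p.1 p.2) ∧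
    (∀ x, H 0 x = x) ∧ (H 1) '' K = K'

/-- The standard (right-handed) `(p, q)` torus curve, on the torus obtained by rotating a circle
of radius `1` whose centre has distance `2` from the vertical axis.  It runs `q` times around the
axis and `p` times around the rotated circle.  It is a knot when `p` and `q` are coprime. -/
noncomputable def torusKnot (p q : ℕ) : Set Space3 :=
  Set.range fun t : ℝ =>
    (((2 + Real.cos (p * t) : ℝ) : ℂ) * Complex.exp (((q * t : ℝ) : ℂ) * Complex.I),
      -Real.sin (p * t))

/-- A closed ribbon folded flat in the plane `ℂ`.

The ribbon, unrolled periodically, is the strip of points `(t, s)`, where `t ∈ ℝ` is arc length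
along the centre line and `|s| ≤ width / 2`.  The point `(t + length, s)` is glued to
`(t, ± s)`; the sign is forced to be `(-1) ^ numFolds`, since each fold turns the ribbon over
(so the closed ribbon is an annulus or a Möbius band).
Fold number `i` is the straight crease `t = foldPos i + foldSlope i * s`, running from one edge of
the strip to the other.  Different creases do not meet inside the strip (they may meet on an
edge).  Panel `i` lies between creases `i` and `i + 1`.  It is placed in the plane by an
isometry, which preserves orientation for even `i` and reverses it for odd `i`. -/
structure FoldedRibbon where
  width : ℝ
  length : ℝ
  width_pos : 0 < width
  length_pos : 0 < length
  /-- number of folds of the closed ribbon -/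
  numFolds : ℕ
  numFolds_pos : 0 < numFolds
  foldPos : ℤ → ℝ
  foldSlope : ℤ → ℝ
  foldPos_periodic : ∀ i, foldPos (i + numFolds) = foldPos i + length
  foldSlope_periodic : ∀ i, foldSlope (i + numFolds) = (-1) ^ numFolds * foldSlope i
  folds_ordered : ∀ i s, |s| < width / 2 →
    foldPos i + foldSlope i * s < foldPos (i + 1) + foldSlope (i + 1) * s
  /-- the position in the plane of the point `(t, s)` of the ribbon -/
  toPlane : ℝ → ℝ → ℂ
  panel_isometry : ∀ i : ℤ, ∃ a d : ℂ, ‖d‖ = 1 ∧ ∀ t s : ℝ, |s| ≤ width / 2 →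
    foldPos i + foldSlope i * s ≤ t → t ≤ foldPos (i + 1) + foldSlope (i + 1) * s →
    toPlane t s = a + d * ((t : ℂ) + (-1) ^ i * (s : ℂ) * Complex.I)
  toPlane_closed : ∀ t s, |s| ≤ width / 2 →
    toPlane (t + length) s = toPlane t ((-1) ^ numFolds * s)

namespace FoldedRibbon

/-- The length-to-width ratio, the length being measured along the centre line. -/
noncomputable def ratio (R : FoldedRibbon) : ℝ := R.length / R.width

/-- A layering of a folded ribbon: a height function on the ribbon without its edges, so that the
ribbon lifted to these heights is embedded in three-space.  (Scaling the heights to zero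
exhibits the flat ribbon as a limit of embedded ribbons.  Since the edges are left out,
they may touch, as the ends of neighbouring folds of a ribbon polygon do.) -/
structure Layering (R : FoldedRibbon) where
  height : ℝ → ℝ → ℝ
  height_continuous :
    ContinuousOn (fun p : ℝ × ℝ => height p.1 p.2) {p | |p.2| < R.width / 2}
  height_closed : ∀ t s, |s| < R.width / 2 →
    height (t + R.length) s = height t ((-1) ^ R.numFolds * s)
  /-- points of the lifted ribbon coincide only if they are glued -/
  embedded : ∀ t s t' s', |s| < R.width / 2 → |s'| < R.width / 2 →
    R.toPlane t s = R.toPlane t' s' → height t s = height t' s' →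
    ∃ k : ℤ, t' = t + k * R.length ∧ s' = ((-1) ^ R.numFolds) ^ k * s

/-- The knot formed by a layered folded ribbon: its lifted centre line. -/
def Layering.core {R : FoldedRibbon} (h : R.Layering) : Set Space3 :=
  Set.range fun t : ℝ => (R.toPlane t 0, h.height t 0)

/-- The folded ribbon, with a suitable layering, is tied as the knot `K`. -/
def Presents (R : FoldedRibbon) (K : Set Space3) : Prop :=
  ∃ h : R.Layering, AmbientIsotopic h.core K

/-- The set of points of the plane covered by the folded ribbon. -/
def image (R : FoldedRibbon) : Set ℂ :=
  {z | ∃ t s : ℝ, |s| ≤ R.width / 2 ∧ z = R.toPlane t s}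

/-- Fold line number `i`, as a subset of the plane. -/
def foldLine (R : FoldedRibbon) (i : ℤ) : Set ℂ :=
  {z | ∃ s : ℝ, |s| ≤ R.width / 2 ∧ z = R.toPlane (R.foldPos i + R.foldSlope i * s) s}

end FoldedRibbon

/-- Vertex `k` of the regular `n`-gon with centre `c` and vertex `0` at `c + z`. -/
noncomputable def regularVertex (n : ℕ) (c z : ℂ) (k : ℤ) : ℂ :=
  c + z * Complex.exp (2 * Real.pi * Complex.I * k / n)

/-- The folded ribbon forms a regular `n`-gon: it has `n` folds, the fold lines are exactly the
sides of some regular `n`-gon, and the whole ribbon lies in that polygon.  (The ribbon may leave a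
hole around the centre.) -/
def FoldedRibbon.FormsRegularPolygon (R : FoldedRibbon) (n : ℕ) : Prop :=
  R.numFolds = n ∧ ∃ c z : ℂ, z ≠ 0 ∧
    Set.range R.foldLine =
      Set.range (fun k : ℤ => segment ℝ (regularVertex n c z k) (regularVertex n c z (k + 1))) ∧
    R.image ⊆ convexHull ℝ (Set.range (regularVertex n c z))

/-- The (closed) Ribbonlength of `K`: the infimum of the length-to-width ratios of all folded
ribbons tied as `K` (it is `∞` if there is none). -/
noncomputable def ribbonlength (K : Set Space3) : ENNReal :=
  ⨅ (R : FoldedRibbon) (_ : R.Presents K), ENNReal.ofReal R.ratio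

/-! Take the regular `n`-gon of apothem 1, so that its sides touch the unit circle at their
midpoints, and put β = qπ/n (`halfAngle`). The centre line is the star polygon on these midpoints:
`n` chords of length 2 sin β at distance cos β from the centre, forming one closed curve because `n`
and `q` are coprime. The sides have length 2 tan(π/n) and meet the chords at angle β. Using them as
creases forces the width 2 tan(π/n) sin β, and sin β cancels from the ratio. The ribbon is an
annulus because `n` is even.

Layering: a point at signed distance x from the middle of its panel gets height `bump` · x, where
`bump` depends only on the point of the plane, vanishes on the sides and is positive inside. Heights
therefore agree (as 0) at the creases. If two lifted points coincide over an interior point, they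
have the same x. They also have the same distance from the centre, hence the same coordinate across
the panel, since that coordinate is positive: 2q + 2 ≤ n keeps the centre out of the open strip. So
the two panels are rotated by the same angle, and coprimality identifies them (`lift_embedded`).
Over a side only the panels of one crease occur (`dvd_of_dirCoord_panelMap_eq`).

Knot type: on the centre line `bump` equals 2√(1 - ‖p‖²)/sin²β. With x = sin β sin(u/2) the height
is sin u, and a radial rescaling moves the chord to the torus points with (radius, height) = (2 -
cos u, sin u). The remaining difference in angle from the torus knot depends only on u and vanishes
at u = ±π, so a rotation about the axis by an angle depending on radius and height removes it. Both
maps are isotopic to the identity (`ambientIsotopic_stretch`, `ambientIsotopic_twist`). -/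

namespace StarRibbon

/-! ### Unit complex numbers and coordinates in a given direction. -/

/-- The point of the unit circle at angle `x`. -/
noncomputable def cis (x : ℝ) : ℂ := Complex.exp (x * Complex.I)

@[simp] lemma cis_re (x : ℝ) : (cis x).re = Real.cos x := Complex.exp_ofReal_mul_I_re x

@[simp] lemma cis_im (x : ℝ) : (cis x).im = Real.sin x := Complex.exp_ofReal_mul_I_im x

lemma cis_add (x y : ℝ) : cis (x + y) = cis x * cis y := by
  simp only [cis, ← Complex.exp_add]; congr 1; push_cast; ring

@[simp] lemma cis_zero : cis 0 = 1 := by simp [cis]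

@[simp] lemma norm_cis (x : ℝ) : ‖cis x‖ = 1 := Complex.norm_exp_ofReal_mul_I x

lemma cis_ne_zero (x : ℝ) : cis x ≠ 0 := Complex.exp_ne_zero _

lemma cis_eq_cis_iff {x y : ℝ} : cis x = cis y ↔ ∃ m : ℤ, x = y + m * (2 * Real.pi) := by
  simp only [cis, Complex.exp_eq_exp_iff_exists_int]
  refine exists_congr fun m => ?_
  rw [show (y : ℂ) * Complex.I + m * (2 * Real.pi * Complex.I)
    = ((y + m * (2 * Real.pi) : ℝ) : ℂ) * Complex.I by push_cast; ring,
    mul_left_inj' Complex.I_ne_zero, Complex.ofReal_inj]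

lemma continuous_cis : Continuous cis := by unfold cis; fun_prop

/-- The coordinate of `p` in the direction of angle `θ`. -/
noncomputable def dirCoord (θ : ℝ) (p : ℂ) : ℝ := p.re * Real.cos θ + p.im * Real.sin θ

lemma dirCoord_cis_mul (θ φ : ℝ) (w : ℂ) : dirCoord θ (cis φ * w) = dirCoord (θ - φ) w := by
  simp only [dirCoord, Complex.mul_re, Complex.mul_im, cis_re, cis_im, Real.cos_sub, Real.sin_sub]
  ring

lemma dirCoord_add (θ : ℝ) (p r : ℂ) : dirCoord θ (p + r) = dirCoord θ p + dirCoord θ r := by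
  simp only [dirCoord, Complex.add_re, Complex.add_im]; ring

lemma dirCoord_ofReal_mul (θ a : ℝ) (p : ℂ) : dirCoord θ (a * p) = a * dirCoord θ p := by
  simp only [dirCoord, Complex.re_ofReal_mul, Complex.im_ofReal_mul]; ring

lemma dirCoord_cis (θ φ : ℝ) : dirCoord θ (cis φ) = Real.cos (φ - θ) := by
  simp only [dirCoord, cis_re, cis_im, Real.cos_sub]

lemma dirCoord_le_norm (θ : ℝ) (p : ℂ) : dirCoord θ p ≤ ‖p‖ := by
  have h : dirCoord θ p = (cis (-θ) * p).re := by simp [dirCoord]; ring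
  rw [h]
  exact (Complex.re_le_norm _).trans (by simp)

lemma dirCoord_periodic (θ : ℝ) (m : ℤ) (p : ℂ) :
    dirCoord (θ + m * (2 * Real.pi)) p = dirCoord θ p := by
  simp only [dirCoord, Real.cos_add_int_mul_two_pi, Real.sin_add_int_mul_two_pi]

lemma continuous_dirCoord (θ : ℝ) : Continuous (dirCoord θ) := by unfold dirCoord; fun_prop

/-! ### The alternating sign of the panels. -/

section Sign

/-- The sign `(-1) ^ i`. -/
noncomputable def sgn (i : ℤ) : ℝ := (-1) ^ i

lemma sgn_add_one (i : ℤ) : sgn (i + 1) = -sgn i := by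
  simp [sgn, zpow_add₀]

lemma sgn_mul_self (i : ℤ) : sgn i * sgn i = 1 := by
  rw [sgn, ← zpow_add₀ (by norm_num), Even.neg_one_zpow ⟨i, rfl⟩]

lemma abs_sgn_mul (i : ℤ) (s : ℝ) : |sgn i * s| = |s| := by
  rw [abs_mul]
  have : |sgn i| = 1 := by
    rw [sgn, abs_zpow]; simp
  rw [this, one_mul]

lemma sgn_add_even {n : ℕ} (hn : Even n) (m i : ℤ) : sgn (i + m * n) = sgn i := by
  rw [sgn, sgn, zpow_add₀ (by norm_num), Even.neg_one_zpow (n := m * n), mul_one]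
  exact (by exact_mod_cast hn : Even (n : ℤ)).mul_left m

end Sign

/-! ### Vertices against side lines: cosines of odd multiples of π/n. -/

section OddMultiples

/-- For d = π/n and 0 ≤ j ≤ n - 1 both sines are nonnegative, and they vanish only at the ends. This
decides which vertices lie on a given side line. -/
lemma cos_sub_cos_odd (d j : ℝ) :
    Real.cos d - Real.cos ((2 * j + 1) * d) = 2 * (Real.sin (j * d) * Real.sin ((j + 1) * d)) := by
  rw [Real.cos_sub_cos, show (d + (2 * j + 1) * d) / 2 = (j + 1) * d by ring,
    show (d - (2 * j + 1) * d) / 2 = -(j * d) by ring, Real.sin_neg]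
  ring

lemma cos_odd_reduce {n : ℕ} (hn : 0 < n) (j : ℤ) :
    Real.cos ((2 * j + 1) * (Real.pi / n))
      = Real.cos ((2 * ((j % n : ℤ) : ℝ) + 1) * (Real.pi / n)) := by
  have hn' : (n : ℝ) ≠ 0 := by positivity
  have hj : (j : ℝ) = ((j % n : ℤ) : ℝ) + n * ((j / n : ℤ) : ℝ) := by
    exact_mod_cast (Int.emod_add_mul_ediv j n).symm
  have h : (2 * (j : ℝ) + 1) * (Real.pi / n)
      = (2 * ((j % n : ℤ) : ℝ) + 1) * (Real.pi / n) + ((j / n : ℤ) : ℝ) * (2 * Real.pi) := by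
    rw [hj]; field_simp; ring
  rw [h, Real.cos_add_int_mul_two_pi]

lemma sin_mul_nonneg {n : ℕ} (hn : 0 < n) {a : ℝ} (h0 : 0 ≤ a) (h1 : a ≤ n) :
    0 ≤ Real.sin (a * (Real.pi / n)) := by
  have hn' : (0 : ℝ) < n := by exact_mod_cast hn
  apply Real.sin_nonneg_of_nonneg_of_le_pi
  · positivity
  · rw [← mul_div_assoc, div_le_iff₀ hn']
    nlinarith [Real.pi_pos]

lemma sin_mul_pos {n : ℕ} (hn : 0 < n) {a : ℝ} (h0 : 0 < a) (h1 : a < n) :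
    0 < Real.sin (a * (Real.pi / n)) := by
  have hn' : (0 : ℝ) < n := by exact_mod_cast hn
  apply Real.sin_pos_of_pos_of_lt_pi
  · positivity
  · rw [← mul_div_assoc, div_lt_iff₀ hn']
    nlinarith [Real.pi_pos]

lemma cos_odd_le {n : ℕ} (hn : 0 < n) (j : ℤ) :
    Real.cos ((2 * j + 1) * (Real.pi / n)) ≤ Real.cos (Real.pi / n) := by
  have hn' : (0 : ℤ) < n := by exact_mod_cast hn
  rw [cos_odd_reduce hn]
  have h0 : (0 : ℝ) ≤ ((j % n : ℤ) : ℝ) := by exact_mod_cast Int.emod_nonneg j hn'.ne'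
  have h1 : ((j % n : ℤ) : ℝ) + 1 ≤ n := by exact_mod_cast Int.emod_lt_of_pos j hn'
  have := cos_sub_cos_odd (Real.pi / n) ((j % n : ℤ) : ℝ)
  have := mul_nonneg (sin_mul_nonneg hn h0 (by linarith)) (sin_mul_nonneg hn (by linarith) h1)
  linarith

lemma cos_odd_lt {n : ℕ} (hn : 0 < n) (j : ℤ) (h : ¬ (n : ℤ) ∣ j) (h' : ¬ (n : ℤ) ∣ j + 1) :
    Real.cos ((2 * j + 1) * (Real.pi / n)) < Real.cos (Real.pi / n) := by
  have hn' : (0 : ℤ) < n := by exact_mod_cast hn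
  rw [cos_odd_reduce hn]
  have e0 : 0 < j % n := lt_of_le_of_ne (Int.emod_nonneg j hn'.ne')
    fun e => h (Int.dvd_of_emod_eq_zero e.symm)
  have e1 : j % n + 1 < n := by
    refine lt_of_le_of_ne (Int.emod_lt_of_pos j hn') fun e => h' ?_
    have := Int.emod_add_mul_ediv j n
    exact ⟨j / n + 1, by linarith⟩
  have h0 : (0 : ℝ) < ((j % n : ℤ) : ℝ) := by exact_mod_cast e0
  have h1 : ((j % n : ℤ) : ℝ) + 1 < n := by exact_mod_cast e1
  have := cos_sub_cos_odd (Real.pi / n) ((j % n : ℤ) : ℝ)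
  have := mul_pos (sin_mul_pos hn h0 (by linarith)) (sin_mul_pos hn (by linarith) h1)
  linarith

/-- If the two ends of another side both lay on the given side line, `n` would divide 2; so at least
one of the two cosines is strictly smaller. -/
lemma cos_odd_combination_lt {n : ℕ} (hn : 3 ≤ n) {j : ℤ} (hj : ¬ (n : ℤ) ∣ j) {l : ℝ}
    (h0 : 0 < l) (h1 : l < 1) :
    l * Real.cos ((2 * j - 1) * (Real.pi / n)) + (1 - l) * Real.cos ((2 * j + 1) * (Real.pi / n))
      < Real.cos (Real.pi / n) := by
  have hpos : 0 < n := by omega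
  have a := cos_odd_le hpos j
  have b := cos_odd_le hpos (j - 1)
  rw [show (2 * ((j - 1 : ℤ) : ℝ) + 1) = 2 * j - 1 by push_cast; ring] at b
  by_cases h : (n : ℤ) ∣ j + 1
  · have h2 : ¬ (n : ℤ) ∣ j - 1 := fun h3 => by
      have h4 := dvd_sub h h3
      rw [show j + 1 - (j - 1) = 2 by ring] at h4
      have := Int.le_of_dvd (by norm_num) h4
      omega
    have c := cos_odd_lt hpos (j - 1) h2 (by simpa using hj)
    rw [show (2 * ((j - 1 : ℤ) : ℝ) + 1) = 2 * j - 1 by push_cast; ring] at c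
    nlinarith
  · have c := cos_odd_lt hpos j hj h
    nlinarith

end OddMultiples

/-! ### Inequalities for the angle and the width. -/

section Angles

/-- Half of the angle subtended by a chord that skips `q` sides of the regular `n`-gon. -/
noncomputable def halfAngle (n q : ℕ) : ℝ := q * (Real.pi / n)

/-- Half of the width of the ribbon. -/
noncomputable def halfWidth (n q : ℕ) : ℝ := Real.tan (Real.pi / n) * Real.sin (halfAngle n q)

lemma pi_div_pos {n : ℕ} (hn : 0 < n) : 0 < Real.pi / n := by
  have : (0 : ℝ) < n := by exact_mod_cast hn
  positivity

lemma halfAngle_add_le {n q : ℕ} (hn : 2 * q + 2 ≤ n) :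
    halfAngle n q + Real.pi / n ≤ Real.pi / 2 := by
  have h : (0 : ℝ) < n := by exact_mod_cast (by omega : 0 < n)
  have h' : 2 * (q : ℝ) + 2 ≤ n := by exact_mod_cast hn
  rw [halfAngle, ← mul_div_assoc, ← add_div, div_le_div_iff₀ h two_pos]
  nlinarith [Real.pi_pos]

lemma pi_div_lt_halfAngle {n q : ℕ} (hq : 2 ≤ q) (hn : 2 * q + 2 ≤ n) :
    Real.pi / n < halfAngle n q := by
  have h := pi_div_pos (by omega : 0 < n)
  have h' : (2 : ℝ) ≤ q := by exact_mod_cast hq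
  rw [halfAngle]; nlinarith

lemma halfAngle_mem {n q : ℕ} (hq : 2 ≤ q) (hn : 2 * q + 2 ≤ n) :
    0 < halfAngle n q ∧ halfAngle n q < Real.pi / 2 := by
  have := pi_div_pos (by omega : 0 < n)
  have := halfAngle_add_le hn
  have := pi_div_lt_halfAngle hq hn
  constructor <;> linarith

lemma cos_pi_div_pos {n : ℕ} (hn : 3 ≤ n) : 0 < Real.cos (Real.pi / n) := by
  have h := pi_div_pos (by omega : 0 < n)
  apply Real.cos_pos_of_mem_Ioo
  constructor
  · linarith [Real.pi_pos]
  · apply div_lt_div_of_pos_left Real.pi_pos two_pos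
    exact_mod_cast (by omega : 2 < n)

lemma sin_pi_div_pos {n : ℕ} (hn : 3 ≤ n) : 0 < Real.sin (Real.pi / n) := by
  apply Real.sin_pos_of_pos_of_lt_pi (pi_div_pos (by omega))
  apply div_lt_self Real.pi_pos
  exact_mod_cast (by omega : 1 < n)

lemma sin_halfAngle_pos {n q : ℕ} (hq : 2 ≤ q) (hn : 2 * q + 2 ≤ n) :
    0 < Real.sin (halfAngle n q) := by
  have := halfAngle_mem hq hn
  exact Real.sin_pos_of_pos_of_lt_pi this.1 (by linarith [Real.pi_pos])

lemma cos_halfAngle_pos {n q : ℕ} (hq : 2 ≤ q) (hn : 2 * q + 2 ≤ n) :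
    0 < Real.cos (halfAngle n q) := by
  have := halfAngle_mem hq hn
  exact Real.cos_pos_of_mem_Ioo ⟨by linarith [Real.pi_pos], this.2⟩

lemma halfWidth_pos {n q : ℕ} (hq : 2 ≤ q) (hn : 2 * q + 2 ≤ n) : 0 < halfWidth n q := by
  have h3 : 3 ≤ n := by omega
  rw [halfWidth, Real.tan_eq_sin_div_cos]
  exact mul_pos (div_pos (sin_pi_div_pos h3) (cos_pi_div_pos h3)) (sin_halfAngle_pos hq hn)

/-- The centre of the polygon does not lie in the interior of the strip. -/
lemma halfWidth_le_cos {n q : ℕ} (hq : 2 ≤ q) (hn : 2 * q + 2 ≤ n) :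
    halfWidth n q ≤ Real.cos (halfAngle n q) := by
  have h3 : 3 ≤ n := by omega
  have hc := cos_pi_div_pos h3
  -- This is where 2q + 2 ≤ n enters: it gives β + π/n ≤ π/2.
  have h : 0 ≤ Real.cos (halfAngle n q + Real.pi / n) := by
    apply Real.cos_nonneg_of_neg_pi_div_two_le_of_le _ (halfAngle_add_le hn)
    linarith [(halfAngle_mem hq hn).1, pi_div_pos (by omega : 0 < n), Real.pi_pos]
  rw [Real.cos_add] at h
  rw [halfWidth, Real.tan_eq_sin_div_cos, div_mul_eq_mul_div, div_le_iff₀ hc]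
  linarith

/-- Consecutive creases do not meet in the closed strip. -/
lemma halfWidth_mul_cot_lt {n q : ℕ} (hq : 2 ≤ q) (hn : 2 * q + 2 ≤ n) :
    halfWidth n q * Real.cot (halfAngle n q) < Real.sin (halfAngle n q) := by
  have h3 : 3 ≤ n := by omega
  have hc := cos_pi_div_pos h3
  have hs := sin_halfAngle_pos hq hn
  -- This is where 2 ≤ q enters: it gives π/n < β.
  have h : 0 < Real.sin (halfAngle n q - Real.pi / n) := by
    apply Real.sin_pos_of_pos_of_lt_pi
    · linarith [pi_div_lt_halfAngle hq hn]
    · linarith [(halfAngle_mem hq hn).2, pi_div_pos (by omega : 0 < n), Real.pi_pos]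
  rw [Real.sin_sub] at h
  rw [halfWidth, Real.cot_eq_cos_div_sin, Real.tan_eq_sin_div_cos,
    show ∀ a b c d : ℝ, a / b * c * (d / c) = a * d * (c / c) / b by intros; ring,
    div_self hs.ne', mul_one, div_lt_iff₀ hc]
  linarith

end Angles

/-! ### Panels as trapezoids spanned by two sides of the polygon. -/

section Panels

/-- The panel with index `i` of the ribbon, as a rigid motion of the strip. -/
noncomputable def panelMap (n q : ℕ) (i : ℤ) (t s : ℝ) : ℂ :=
  cis ((2 * i + 1) * halfAngle n q) *
    ((Real.cos (halfAngle n q) - sgn i * s : ℝ)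
      + (t - i * (2 * Real.sin (halfAngle n q)) : ℝ) * Complex.I)

/-- The position along the strip of the crease with index `i`. -/
noncomputable def crease (n q : ℕ) (i : ℤ) (s : ℝ) : ℝ :=
  (i - 1 / 2) * (2 * Real.sin (halfAngle n q)) + -(sgn i * Real.cot (halfAngle n q)) * s

/-- The vertex with index `c` of the regular `n`-gon of apothem `1`; the vertices `c` and `c + 1`
span the side whose midpoint has angle `2 π c / n`. -/
noncomputable def vert (n : ℕ) (c : ℤ) : ℂ :=
  ((1 / Real.cos (Real.pi / n) : ℝ) : ℂ) * cis ((2 * c - 1) * (Real.pi / n))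

/-- The relative position across the strip, from `0` to `1`. -/
noncomputable def across (n q : ℕ) (i : ℤ) (s : ℝ) : ℝ := (sgn i * s / halfWidth n q + 1) / 2

/-- The relative position along a panel, from `-1` to `1`. -/
noncomputable def along (n q : ℕ) (i : ℤ) (t s : ℝ) : ℝ :=
  (t - i * (2 * Real.sin (halfAngle n q))) /
    (Real.sin (halfAngle n q) + sgn i * s * Real.cot (halfAngle n q))

lemma panel_length_pos {n q : ℕ} (hq : 2 ≤ q) (hn : 2 * q + 2 ≤ n) (i : ℤ) {s : ℝ}
    (hs : |s| ≤ halfWidth n q) :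
    0 < Real.sin (halfAngle n q) + sgn i * s * Real.cot (halfAngle n q) := by
  have h := halfWidth_mul_cot_lt hq hn
  have hc : 0 < Real.cot (halfAngle n q) := by
    rw [Real.cot_eq_cos_div_sin]
    exact div_pos (cos_halfAngle_pos hq hn) (sin_halfAngle_pos hq hn)
  rw [← abs_sgn_mul i] at hs
  have := (abs_le.1 hs).1
  nlinarith

lemma crease_add_one (n q : ℕ) (i : ℤ) (s : ℝ) :
    crease n q (i + 1) s = i * (2 * Real.sin (halfAngle n q)) +
      (Real.sin (halfAngle n q) + sgn i * s * Real.cot (halfAngle n q)) := by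
  rw [crease, sgn_add_one]; push_cast; ring

lemma crease_eq (n q : ℕ) (i : ℤ) (s : ℝ) :
    crease n q i s = i * (2 * Real.sin (halfAngle n q)) -
      (Real.sin (halfAngle n q) + sgn i * s * Real.cot (halfAngle n q)) := by
  rw [crease]; ring

lemma crease_lt {n q : ℕ} (hq : 2 ≤ q) (hn : 2 * q + 2 ≤ n) (i : ℤ) {s : ℝ}
    (hs : |s| ≤ halfWidth n q) : crease n q i s < crease n q (i + 1) s := by
  rw [crease_add_one, crease_eq]
  linarith [panel_length_pos hq hn i hs]

lemma along_le_one_iff {n q : ℕ} (hq : 2 ≤ q) (hn : 2 * q + 2 ≤ n) (i : ℤ) {t s : ℝ}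
    (hs : |s| ≤ halfWidth n q) : along n q i t s ≤ 1 ↔ t ≤ crease n q (i + 1) s := by
  rw [along, div_le_one (panel_length_pos hq hn i hs), crease_add_one]
  constructor <;> intro h <;> linarith

lemma neg_one_le_along_iff {n q : ℕ} (hq : 2 ≤ q) (hn : 2 * q + 2 ≤ n) (i : ℤ) {t s : ℝ}
    (hs : |s| ≤ halfWidth n q) : -1 ≤ along n q i t s ↔ crease n q i s ≤ t := by
  rw [along, le_div_iff₀ (panel_length_pos hq hn i hs), crease_eq]
  constructor <;> intro h <;> linarith

lemma one_le_along_iff {n q : ℕ} (hq : 2 ≤ q) (hn : 2 * q + 2 ≤ n) (i : ℤ) {t s : ℝ}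
    (hs : |s| ≤ halfWidth n q) : 1 ≤ along n q i t s ↔ crease n q (i + 1) s ≤ t := by
  rw [along, one_le_div (panel_length_pos hq hn i hs), crease_add_one]
  constructor <;> intro h <;> linarith

lemma across_mem {n q : ℕ} (hq : 2 ≤ q) (hn : 2 * q + 2 ≤ n) (i : ℤ) {s : ℝ}
    (hs : |s| ≤ halfWidth n q) : 0 ≤ across n q i s ∧ across n q i s ≤ 1 := by
  have hw := halfWidth_pos hq hn
  rw [← abs_sgn_mul i, abs_le] at hs
  have h1 : -1 ≤ sgn i * s / halfWidth n q := by rw [le_div_iff₀ hw]; linarith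
  have h2 : sgn i * s / halfWidth n q ≤ 1 := by rw [div_le_iff₀ hw]; linarith
  rw [across]; constructor <;> linarith

lemma across_mem_Ioo {n q : ℕ} (hq : 2 ≤ q) (hn : 2 * q + 2 ≤ n) (i : ℤ) {s : ℝ}
    (hs : |s| < halfWidth n q) : 0 < across n q i s ∧ across n q i s < 1 := by
  have hw := halfWidth_pos hq hn
  rw [← abs_sgn_mul i, abs_lt] at hs
  have h1 : -1 < sgn i * s / halfWidth n q := by rw [lt_div_iff₀ hw]; linarith
  have h2 : sgn i * s / halfWidth n q < 1 := by rw [div_lt_iff₀ hw]; linarith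
  rw [across]; constructor <;> linarith

/-- A point of a panel as a combination of four vertices of the polygon. -/
lemma panelMap_eq_vert {n q : ℕ} (hq : 2 ≤ q) (hn : 2 * q + 2 ≤ n) (i : ℤ) (t : ℝ) {s : ℝ}
    (hs : |s| ≤ halfWidth n q) :
    panelMap n q i t s =
      (((1 + along n q i t s) / 2 : ℝ) : ℂ) *
        ((across n q i s : ℝ) * vert n (q * (i + 1) + 1)
          + (1 - across n q i s : ℝ) * vert n (q * (i + 1)))
      + (((1 - along n q i t s) / 2 : ℝ) : ℂ) *
        ((across n q i s : ℝ) * vert n (q * i) + (1 - across n q i s : ℝ) * vert n (q * i + 1)) := by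
  have h3 : 3 ≤ n := by omega
  have hc := (cos_pi_div_pos h3).ne'
  have hd := (sin_pi_div_pos h3).ne'
  have hsb := (sin_halfAngle_pos hq hn).ne'
  have hlen := (panel_length_pos hq hn i hs).ne'
  have hx : t - i * (2 * Real.sin (halfAngle n q)) = along n q i t s *
      (Real.sin (halfAngle n q) + sgn i * s * Real.cot (halfAngle n q)) := by
    rw [along, div_mul_cancel₀ _ hlen]
  have hw : sgn i * s = (2 * across n q i s - 1) *
      (Real.sin (Real.pi / n) / Real.cos (Real.pi / n) * Real.sin (halfAngle n q)) := by
    rw [across, halfWidth, Real.tan_eq_sin_div_cos]; field_simp; ring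
  rw [panelMap, hx, hw, Real.cot_eq_cos_div_sin]
  generalize along n q i t s = k
  generalize across n q i s = l
  have hv : ∀ (c : ℤ) (y : ℝ), (2 * c - 1) * (Real.pi / n) = (2 * i + 1) * halfAngle n q + y →
      vert n c = cis ((2 * i + 1) * halfAngle n q) *
        (((1 / Real.cos (Real.pi / n) : ℝ) : ℂ) * cis y) := by
    intro c y h
    rw [vert, h, cis_add]; ring
  rw [hv (q * (i + 1) + 1) (halfAngle n q + Real.pi / n) (by rw [halfAngle]; push_cast; ring),
    hv (q * (i + 1)) (halfAngle n q - Real.pi / n) (by rw [halfAngle]; push_cast; ring),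
    hv (q * i) (-(halfAngle n q + Real.pi / n)) (by rw [halfAngle]; push_cast; ring),
    hv (q * i + 1) (-(halfAngle n q - Real.pi / n)) (by rw [halfAngle]; push_cast; ring)]
  generalize cis ((2 * i + 1) * halfAngle n q) = u
  have key : (((Real.cos (halfAngle n q) - (2 * l - 1) *
      (Real.sin (Real.pi / n) / Real.cos (Real.pi / n) * Real.sin (halfAngle n q)) : ℝ) : ℂ)
      + ((k * (Real.sin (halfAngle n q) + (2 * l - 1) *
      (Real.sin (Real.pi / n) / Real.cos (Real.pi / n) * Real.sin (halfAngle n q)) *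
      (Real.cos (halfAngle n q) / Real.sin (halfAngle n q))) : ℝ) : ℂ) * Complex.I)
      = (((1 + k) / 2 : ℝ) : ℂ) *
        ((l : ℝ) * (((1 / Real.cos (Real.pi / n) : ℝ) : ℂ) * cis (halfAngle n q + Real.pi / n))
          + (1 - l : ℝ) * (((1 / Real.cos (Real.pi / n) : ℝ) : ℂ) *
            cis (halfAngle n q - Real.pi / n)))
      + (((1 - k) / 2 : ℝ) : ℂ) *
        ((l : ℝ) * (((1 / Real.cos (Real.pi / n) : ℝ) : ℂ) * cis (-(halfAngle n q + Real.pi / n)))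
          + (1 - l : ℝ) * (((1 / Real.cos (Real.pi / n) : ℝ) : ℂ) *
            cis (-(halfAngle n q - Real.pi / n)))) := by
    apply Complex.ext
    · simp only [Complex.add_re, Complex.re_ofReal_mul, Complex.ofReal_re, Complex.I_re, cis_re,
        Real.cos_neg, Real.cos_add, Real.cos_sub]
      field_simp; ring
    · simp only [Complex.add_im, Complex.im_ofReal_mul, Complex.ofReal_im, Complex.I_im, cis_im,
        Real.sin_neg, Real.sin_add, Real.sin_sub]
      field_simp; ring
  rw [key]; ring

lemma dirCoord_vert {n : ℕ} (c j : ℤ) :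
    dirCoord (2 * c * (Real.pi / n)) (vert n j) =
      (1 / Real.cos (Real.pi / n)) * Real.cos ((2 * (j - c) - 1) * (Real.pi / n)) := by
  rw [vert, dirCoord_ofReal_mul, dirCoord_cis]
  congr 2; ring

lemma dirCoord_side_le {n : ℕ} (hn : 3 ≤ n) (c j : ℤ) {l : ℝ} (h0 : 0 ≤ l) (h1 : l ≤ 1) :
    dirCoord (2 * c * (Real.pi / n)) ((l : ℂ) * vert n (j + 1) + (1 - l : ℝ) * vert n j) ≤ 1 := by
  have hc := cos_pi_div_pos hn
  have a := cos_odd_le (by omega : 0 < n) (j - c)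
  have b := cos_odd_le (by omega : 0 < n) (j - c - 1)
  rw [dirCoord_add, dirCoord_ofReal_mul, dirCoord_ofReal_mul, dirCoord_vert, dirCoord_vert]
  push_cast at a b ⊢
  rw [show 2 * ((j : ℝ) + 1 - c) - 1 = 2 * (j - c) + 1 by ring]
  rw [show 2 * ((j : ℝ) - c - 1) + 1 = 2 * (j - c) - 1 by ring] at b
  have e : l * (1 / Real.cos (Real.pi / n) * Real.cos ((2 * (j - c) + 1) * (Real.pi / n))) +
    (1 - l) * (1 / Real.cos (Real.pi / n) * Real.cos ((2 * (j - c) - 1) * (Real.pi / n))) =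
    (l * Real.cos ((2 * (j - c) + 1) * (Real.pi / n)) +
      (1 - l) * Real.cos ((2 * (j - c) - 1) * (Real.pi / n))) / Real.cos (Real.pi / n) := by ring
  rw [e, div_le_one hc]
  nlinarith

lemma dirCoord_side_lt {n : ℕ} (hn : 3 ≤ n) {c j : ℤ} (h : ¬ (n : ℤ) ∣ j - c) {l : ℝ}
    (h0 : 0 < l) (h1 : l < 1) :
    dirCoord (2 * c * (Real.pi / n)) ((l : ℂ) * vert n (j + 1) + (1 - l : ℝ) * vert n j) < 1 := by
  have hc := cos_pi_div_pos hn
  have a := cos_odd_combination_lt hn h (sub_pos.2 h1) (sub_lt_self 1 h0)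
  rw [dirCoord_add, dirCoord_ofReal_mul, dirCoord_ofReal_mul, dirCoord_vert, dirCoord_vert]
  push_cast at a ⊢
  rw [show 2 * ((j : ℝ) + 1 - c) - 1 = 2 * (j - c) + 1 by ring]
  have e : l * (1 / Real.cos (Real.pi / n) * Real.cos ((2 * (j - c) + 1) * (Real.pi / n))) +
    (1 - l) * (1 / Real.cos (Real.pi / n) * Real.cos ((2 * (j - c) - 1) * (Real.pi / n))) =
    (l * Real.cos ((2 * (j - c) + 1) * (Real.pi / n)) +
      (1 - l) * Real.cos ((2 * (j - c) - 1) * (Real.pi / n))) / Real.cos (Real.pi / n) := by ring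
  rw [e, div_lt_one hc]
  linarith

lemma dirCoord_side_eq {n : ℕ} (hn : 3 ≤ n) (c : ℤ) (l : ℝ) :
    dirCoord (2 * c * (Real.pi / n)) ((l : ℂ) * vert n (c + 1) + (1 - l : ℝ) * vert n c) = 1 := by
  have hc := (cos_pi_div_pos hn).ne'
  rw [dirCoord_add, dirCoord_ofReal_mul, dirCoord_ofReal_mul, dirCoord_vert, dirCoord_vert]
  push_cast
  rw [show (2 * ((c : ℝ) + 1 - c) - 1) * (Real.pi / n) = Real.pi / n by ring,
    show (2 * ((c : ℝ) - c) - 1) * (Real.pi / n) = -(Real.pi / n) by ring, Real.cos_neg]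
  field_simp; ring

lemma panelMap_eq_sides {n q : ℕ} (hq : 2 ≤ q) (hn : 2 * q + 2 ≤ n) (i : ℤ) (t : ℝ) {s : ℝ}
    (hs : |s| ≤ halfWidth n q) :
    panelMap n q i t s =
      (((1 + along n q i t s) / 2 : ℝ) : ℂ) *
        ((across n q i s : ℝ) * vert n (q * (i + 1) + 1)
          + (1 - across n q i s : ℝ) * vert n (q * (i + 1)))
      + (((1 - along n q i t s) / 2 : ℝ) : ℂ) *
        ((1 - across n q i s : ℝ) * vert n (q * i + 1)
          + (1 - (1 - across n q i s) : ℝ) * vert n (q * i)) := by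
  rw [panelMap_eq_vert hq hn i t hs, sub_sub_cancel,
    add_comm ((across n q i s : ℂ) * vert n (q * i))]

lemma dirCoord_panelMap_le {n q : ℕ} (hq : 2 ≤ q) (hn : 2 * q + 2 ≤ n) (i c : ℤ) {t s : ℝ}
    (hs : |s| ≤ halfWidth n q) (h0 : crease n q i s ≤ t) (h1 : t ≤ crease n q (i + 1) s) :
    dirCoord (2 * c * (Real.pi / n)) (panelMap n q i t s) ≤ 1 := by
  rw [← neg_one_le_along_iff hq hn i hs] at h0
  rw [← along_le_one_iff hq hn i hs] at h1
  obtain ⟨a0, a1⟩ := across_mem hq hn i hs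
  rw [panelMap_eq_sides hq hn i t hs, dirCoord_add, dirCoord_ofReal_mul, dirCoord_ofReal_mul]
  have := dirCoord_side_le (by omega : 3 ≤ n) c (q * (i + 1)) a0 a1
  have := dirCoord_side_le (by omega : 3 ≤ n) c (q * i) (sub_nonneg.2 a1) (sub_le_self 1 a0)
  nlinarith

/-- The open strip meets the side lines of the polygon only along the creases. -/
lemma dvd_of_dirCoord_panelMap_eq {n q : ℕ} (hq : 2 ≤ q) (hn : 2 * q + 2 ≤ n) (i c : ℤ) {t s : ℝ}
    (hs : |s| < halfWidth n q) (h0 : crease n q i s ≤ t) (h1 : t < crease n q (i + 1) s)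
    (h : dirCoord (2 * c * (Real.pi / n)) (panelMap n q i t s) = 1) :
    (n : ℤ) ∣ q * i - c ∧ t = crease n q i s := by
  have hs' := hs.le
  rw [← neg_one_le_along_iff hq hn i hs'] at h0
  rw [← not_le, ← one_le_along_iff hq hn i hs', not_le] at h1
  obtain ⟨a0, a1⟩ := across_mem_Ioo hq hn i hs
  have h3 : 3 ≤ n := by omega
  rw [panelMap_eq_sides hq hn i t hs', dirCoord_add, dirCoord_ofReal_mul, dirCoord_ofReal_mul] at h
  have le1 := dirCoord_side_le h3 c (q * (i + 1)) a0.le a1.le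
  have le2 := dirCoord_side_le h3 c (q * i) (sub_nonneg.2 a1.le) (sub_le_self 1 a0.le)
  -- The point is a convex combination of a point on side `q * i` and one on side `q * (i + 1)`. The
  -- first has positive weight since `t` lies before the next crease, so it must lie on side line
  -- `c`.
  have d : (n : ℤ) ∣ q * i - c := by
    by_contra hd
    have := dirCoord_side_lt h3 hd (sub_pos.2 a1) (sub_lt_self 1 a0)
    nlinarith
  refine ⟨d, ?_⟩
  -- Otherwise `n` would divide `q`, which is smaller. So the second point is off the side line and
  -- must have weight 0.
  have d' : ¬ (n : ℤ) ∣ q * (i + 1) - c := fun hd => by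
    have := dvd_sub hd d
    rw [show (q * (i + 1) - c - (q * i - c) : ℤ) = q by ring] at this
    have := Int.le_of_dvd (by omega) this
    omega
  have lt1 := dirCoord_side_lt h3 d' a0 a1
  have e : along n q i t s = -1 := by nlinarith
  apply le_antisymm _ ((neg_one_le_along_iff hq hn i hs').1 h0)
  have hlen := panel_length_pos hq hn i hs'
  rw [along, div_eq_iff hlen.ne'] at e
  rw [crease_eq]; linarith

lemma panelMap_crease {n q : ℕ} (hq : 2 ≤ q) (hn : 2 * q + 2 ≤ n) (i : ℤ) {s : ℝ}
    (hs : |s| ≤ halfWidth n q) :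
    panelMap n q i (crease n q i s) s =
      (1 - across n q i s : ℝ) * vert n (q * i + 1) +
        (1 - (1 - across n q i s) : ℝ) * vert n (q * i) := by
  have e : along n q i (crease n q i s) s = -1 := by
    have hlen := panel_length_pos hq hn i hs
    rw [along, div_eq_iff hlen.ne', crease_eq]; ring
  rw [panelMap_eq_sides hq hn i _ hs, e]
  norm_num

lemma panelMap_crease_add_one {n q : ℕ} (hq : 2 ≤ q) (hn : 2 * q + 2 ≤ n) (i : ℤ) {s : ℝ}
    (hs : |s| ≤ halfWidth n q) :
    panelMap n q i (crease n q (i + 1) s) s =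
      panelMap n q (i + 1) (crease n q (i + 1) s) s := by
  have e : along n q i (crease n q (i + 1) s) s = 1 := by
    have hlen := panel_length_pos hq hn i hs
    rw [along, div_eq_iff hlen.ne', crease_add_one]; ring
  -- The fold turns the ribbon over, which exchanges the two edges of the strip.
  have e' : 1 - across n q (i + 1) s = across n q i s := by
    rw [across, across, sgn_add_one]; ring
  rw [panelMap_crease hq hn _ hs, panelMap_eq_sides hq hn i _ hs, e, e']
  norm_num

lemma dirCoord_panelMap_crease {n q : ℕ} (hq : 2 ≤ q) (hn : 2 * q + 2 ≤ n) (i : ℤ) {s : ℝ}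
    (hs : |s| ≤ halfWidth n q) :
    dirCoord (2 * ((q * i : ℤ) : ℝ) * (Real.pi / n)) (panelMap n q i (crease n q i s) s) = 1 := by
  rw [panelMap_crease hq hn i hs]
  exact dirCoord_side_eq (by omega) _ _

/-- Each panel is turned by 2β from the previous one, so `n` panels make `q` full turns; the parity
of `n` restores the orientation. -/
lemma panelMap_add_mul {n q : ℕ} (hn0 : 0 < n) (hne : Even n) (i m : ℤ) (t s : ℝ) :
    panelMap n q (i + m * n) (t + m * (n * (2 * Real.sin (halfAngle n q)))) s
      = panelMap n q i t s := by
  have hn' : (n : ℝ) ≠ 0 := by positivity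
  have h : (2 * ((i + m * n : ℤ) : ℝ) + 1) * halfAngle n q
      = (2 * i + 1) * halfAngle n q + ((m * q : ℤ) : ℝ) * (2 * Real.pi) := by
    rw [halfAngle]; push_cast; field_simp; ring
  rw [panelMap, panelMap, sgn_add_even hne, cis_eq_cis_iff.2 ⟨m * q, h⟩]
  congr 4; push_cast; ring

lemma crease_add_mul {n q : ℕ} (hne : Even n) (i m : ℤ) (s : ℝ) :
    crease n q (i + m * n) s = crease n q i s + m * (n * (2 * Real.sin (halfAngle n q))) := by
  rw [crease, crease, sgn_add_even hne]; push_cast; ring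

end Panels

/-! ### Functions on the strip defined panel by panel. -/

section Glue

/-- The function on the strip that agrees with `F i` between the creases `c i` and `c (i + 1)`. -/
noncomputable def glue {X : Type*} [Zero X] (c : ℤ → ℝ → ℝ) (F : ℤ → ℝ → ℝ → X) (t s : ℝ) : X :=
  open Classical in
  if h : ∃ i, c i s ≤ t ∧ t ≤ c (i + 1) s then F h.choose t s else 0

/-- The arbitrary choice of panel is harmless: two distinct panels containing the same point are
consecutive and the point is on their common crease. -/
lemma glue_eq {X : Type*} [Zero X] {c : ℤ → ℝ → ℝ} {F : ℤ → ℝ → ℝ → X} {s : ℝ}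
    (hc : ∀ i, c i s < c (i + 1) s) (hF : ∀ i, F i (c (i + 1) s) s = F (i + 1) (c (i + 1) s) s)
    {i : ℤ} {t : ℝ} (h0 : c i s ≤ t) (h1 : t ≤ c (i + 1) s) : glue c F t s = F i t s := by
  have mono : StrictMono fun i => c i s := strictMono_int_of_lt_succ hc
  have key : ∀ i j, c i s ≤ t → t ≤ c (i + 1) s → c j s ≤ t → t ≤ c (j + 1) s → i < j →
      F i t s = F j t s := by
    intro i j _ hi1 hj0 _ hij
    have h : c (i + 1) s ≤ c j s := mono.monotone (show i + 1 ≤ j by omega)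
    have e : c (i + 1) s = c j s := le_antisymm h (hj0.trans hi1)
    have e1 : i + 1 = j := mono.injective e
    have e2 : t = c (i + 1) s := le_antisymm hi1 (h.trans hj0)
    rw [e2, hF i, e1]
  have hex : ∃ i, c i s ≤ t ∧ t ≤ c (i + 1) s := ⟨i, h0, h1⟩
  rw [glue, dif_pos hex]
  obtain ⟨j0, j1⟩ := hex.choose_spec
  rcases lt_trichotomy hex.choose i with h | h | h
  · exact key _ _ j0 j1 h0 h1 h
  · rw [h]
  · exact (key _ _ h0 h1 j0 j1 h).symm

end Glue

/-! ### The panels cover the strip and form a locally finite family. -/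

section Creases

lemma panel_length_lt {n q : ℕ} (hq : 2 ≤ q) (hn : 2 * q + 2 ≤ n) (i : ℤ) {s : ℝ}
    (hs : |s| ≤ halfWidth n q) :
    Real.sin (halfAngle n q) + sgn i * s * Real.cot (halfAngle n q)
      < 2 * Real.sin (halfAngle n q) := by
  have h := panel_length_pos hq hn i (s := -s) (by rwa [abs_neg])
  linarith

/-- The last crease not beyond `t` is taken. The half-open interval assigns points of a crease to
the panel that starts there. -/
lemma exists_panel {n q : ℕ} (hq : 2 ≤ q) (hn : 2 * q + 2 ≤ n) (t : ℝ) {s : ℝ}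
    (hs : |s| ≤ halfWidth n q) : ∃ i, crease n q i s ≤ t ∧ t < crease n q (i + 1) s := by
  have hl : 0 < 2 * Real.sin (halfAngle n q) := by linarith [sin_halfAngle_pos hq hn]
  have hb : ∃ b : ℤ, ∀ z, crease n q z s ≤ t → z ≤ b := by
    refine ⟨⌊t / (2 * Real.sin (halfAngle n q)) + 1⌋, fun z hz => ?_⟩
    rw [Int.le_floor, ← sub_le_iff_le_add, le_div_iff₀ hl]
    rw [crease_eq] at hz
    linarith [panel_length_lt hq hn z hs]
  have hi : ∃ z, crease n q z s ≤ t := by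
    refine ⟨⌊t / (2 * Real.sin (halfAngle n q))⌋, ?_⟩
    have := Int.floor_le (t / (2 * Real.sin (halfAngle n q)))
    rw [le_div_iff₀ hl] at this
    rw [crease_eq]
    linarith [panel_length_pos hq hn ⌊t / (2 * Real.sin (halfAngle n q))⌋ hs]
  obtain ⟨i, h0, h1⟩ := Int.exists_greatest_of_bdd hb hi
  refine ⟨i, h0, ?_⟩
  by_contra hcon
  have := h1 _ (not_lt.1 hcon)
  omega

lemma continuous_crease (n q : ℕ) (i : ℤ) : Continuous (crease n q i) := by
  unfold crease; fun_prop

/-- A function on the strip is continuous if it is continuous on every panel. -/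
lemma continuousOn_strip {X : Type*} [TopologicalSpace X] {n q : ℕ} (hq : 2 ≤ q)
    (hn : 2 * q + 2 ≤ n) {f : ℝ → ℝ → X} {F : ℤ → ℝ → ℝ → X}
    (hF : ∀ i, Continuous fun p : ℝ × ℝ => F i p.1 p.2)
    (h : ∀ i t s, |s| ≤ halfWidth n q → crease n q i s ≤ t → t ≤ crease n q (i + 1) s →
      f t s = F i t s) :
    ContinuousOn (fun p : ℝ × ℝ => f p.1 p.2) {p | |p.2| < halfWidth n q} := by
  have hl : 0 < 2 * Real.sin (halfAngle n q) := by linarith [sin_halfAngle_pos hq hn]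
  set A : ℤ → Set (ℝ × ℝ) := fun i =>
    {p | |p.2| ≤ halfWidth n q ∧ crease n q i p.2 ≤ p.1 ∧ p.1 ≤ crease n q (i + 1) p.2} with hA
  have hfin : LocallyFinite A := by
    intro x
    refine ⟨{p | |p.1 - x.1| < 1}, ?_, ?_⟩
    · exact (isOpen_lt (by fun_prop) continuous_const).mem_nhds (by simp)
    · refine (Set.finite_Icc ⌊(x.1 - 1) / (2 * Real.sin (halfAngle n q)) - 1⌋
        ⌊(x.1 + 1) / (2 * Real.sin (halfAngle n q)) + 1⌋).subset ?_
      rintro i ⟨p, ⟨hs, h0, h1⟩, hp⟩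
      obtain ⟨p0, p1⟩ := abs_lt.1 (show |p.1 - x.1| < 1 from hp)
      have := panel_length_lt hq hn i hs
      rw [crease_add_one] at h1
      rw [crease_eq] at h0
      constructor
      · rw [← Int.cast_le (R := ℝ)]
        refine (Int.floor_le _).trans ?_
        rw [sub_le_iff_le_add, div_le_iff₀ hl]
        linarith
      · rw [Int.le_floor, ← sub_le_iff_le_add, le_div_iff₀ hl]
        linarith
  have hcl : ∀ i, IsClosed (A i) := fun i => by
    have h1 := (continuous_crease n q i).comp (continuous_snd (X := ℝ) (Y := ℝ))
    have h2 := (continuous_crease n q (i + 1)).comp (continuous_snd (X := ℝ) (Y := ℝ))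
    exact (isClosed_le (continuous_abs.comp continuous_snd) continuous_const).inter
      ((isClosed_le h1 continuous_fst).inter (isClosed_le continuous_fst h2))
  refine (hfin.continuousOn_iUnion hcl (g := fun p : ℝ × ℝ => f p.1 p.2) fun i =>
    ((hF i).continuousOn.congr fun p hp => h i p.1 p.2 hp.1 hp.2.1 hp.2.2)).mono ?_
  intro p hp
  obtain ⟨i, h0, h1⟩ := exists_panel hq hn p.1 (le_of_lt hp)
  exact Set.mem_iUnion.2 ⟨i, le_of_lt hp, h0, h1.le⟩

end Creases

/-! ### The common factor of the heights. -/

section Bump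

/-- A function which is positive inside the regular `n`-gon of apothem `1`, vanishes on its sides,
and is a multiple of `√(1 - ‖p‖ ^ 2)` on the centre line of the ribbon. -/
noncomputable def bump (n q : ℕ) (p : ℂ) : ℝ :=
  2 / Real.sin (halfAngle n q) ^ 2 * √(1 - ‖p‖ ^ 2) +
    ∏ c ∈ Finset.range n, (1 - dirCoord (2 * c * (Real.pi / n)) p) *
      (dirCoord (2 * c * (Real.pi / n) + halfAngle n q) p - Real.cos (halfAngle n q)) ^ 2

lemma continuous_bump (n q : ℕ) : Continuous (bump n q) := by
  unfold bump
  have := continuous_dirCoord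
  fun_prop

lemma exists_range_dirCoord {n : ℕ} (hn : 0 < n) (c : ℤ) :
    ∃ k ∈ Finset.range n, ∀ (a : ℝ) (p : ℂ), dirCoord (2 * (k : ℝ) * (Real.pi / n) + a) p =
      dirCoord (2 * c * (Real.pi / n) + a) p := by
  have hn' : (0 : ℤ) < n := by exact_mod_cast hn
  have hn'' : (n : ℝ) ≠ 0 := by positivity
  refine ⟨(c % n).toNat, ?_, fun a p => ?_⟩
  · have := Int.emod_lt_of_pos c hn'
    have := Int.emod_nonneg c hn'.ne'
    rw [Finset.mem_range]; omega
  · have h1 : (((c % n).toNat : ℕ) : ℝ) = ((c % n : ℤ) : ℝ) := by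
      exact_mod_cast Int.toNat_of_nonneg (Int.emod_nonneg c hn'.ne')
    have hj : (c : ℝ) = ((c % n : ℤ) : ℝ) + n * ((c / n : ℤ) : ℝ) := by
      exact_mod_cast (Int.emod_add_mul_ediv c n).symm
    rw [h1, ← dirCoord_periodic _ (c / n)]
    congr 1
    rw [hj]; field_simp; ring

lemma bump_eq_zero {n : ℕ} (q : ℕ) (hn : 0 < n) {c : ℤ} {p : ℂ}
    (h : dirCoord (2 * c * (Real.pi / n)) p = 1) : bump n q p = 0 := by
  -- Side lines are tangent to the unit circle, so ‖p‖ ≥ 1 and the root takes its default value 0.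
  have h1 : √(1 - ‖p‖ ^ 2) = 0 := by
    apply Real.sqrt_eq_zero_of_nonpos
    have := dirCoord_le_norm (2 * c * (Real.pi / n)) p
    nlinarith
  obtain ⟨k, hk, e⟩ := exists_range_dirCoord hn c
  have e0 := e 0 p
  rw [add_zero, add_zero, h] at e0
  rw [bump, h1, Finset.prod_eq_zero hk (by rw [e0]; simp)]
  simp

/-- Inside the unit disc the root is positive. Outside it the product can vanish only on the line of
some chord; but the side lines `c` and `c + q`, tangent at the ends of that chord, confine `p` to
the open chord, which lies in the disc. -/
lemma bump_pos {n q : ℕ} (hq : 2 ≤ q) (hn : 2 * q + 2 ≤ n) {p : ℂ}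
    (h : ∀ c : ℤ, dirCoord (2 * c * (Real.pi / n)) p < 1) : 0 < bump n q p := by
  have hs := sin_halfAngle_pos hq hn
  have hcs := Real.sin_sq_add_cos_sq (halfAngle n q)
  have hpos : ∀ c : ℕ, 0 < 1 - dirCoord (2 * c * (Real.pi / n)) p := fun c => by
    have := h c
    rw [Int.cast_natCast] at this
    linarith
  by_cases hp : ‖p‖ < 1
  · have h1 : 0 < √(1 - ‖p‖ ^ 2) := Real.sqrt_pos.2 (by nlinarith [norm_nonneg p])
    exact add_pos_of_pos_of_nonneg (by positivity)
      (Finset.prod_nonneg fun c _ => mul_nonneg (hpos c).le (sq_nonneg _))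
  · refine add_pos_of_nonneg_of_pos (by positivity)
      (Finset.prod_pos fun c _ => mul_pos (hpos c) (even_two.pow_pos ?_))
    intro h0
    set b := halfAngle n q
    set a := 2 * (c : ℝ) * (Real.pi / n)
    set w := cis (-(a + b)) * p with hw
    have hp' : p = cis (a + b) * w := by
      rw [hw, ← mul_assoc, ← cis_add, add_neg_cancel, cis_zero, one_mul]
    have hre : w.re = Real.cos b := by
      rw [hp', dirCoord_cis_mul, sub_self] at h0
      simp only [dirCoord, Real.cos_zero, Real.sin_zero] at h0
      linarith
    have hn1 : 1 ≤ w.re ^ 2 + w.im ^ 2 := by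
      have e : w.re ^ 2 + w.im ^ 2 = ‖p‖ ^ 2 := by
        rw [hp', norm_mul, norm_cis, one_mul, Complex.sq_norm, Complex.normSq_apply]; ring
      rw [e]; nlinarith [not_lt.1 hp]
    have h1 := h c
    have h2 := h (c + q)
    rw [Int.cast_natCast, show 2 * (c : ℝ) * (Real.pi / n) = a from rfl, hp',
      dirCoord_cis_mul] at h1
    rw [show 2 * (((c + q : ℤ)) : ℝ) * (Real.pi / n) = a + 2 * b by
      simp only [a, b, halfAngle]; push_cast; ring, hp', dirCoord_cis_mul,
      show a + 2 * b - (a + b) = b by ring] at h2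
    rw [show a - (a + b) = -b by ring] at h1
    simp only [dirCoord, Real.cos_neg, Real.sin_neg, hre] at h1 h2
    have h3 : w.im < Real.sin b := by nlinarith
    have h4 : -w.im < Real.sin b := by nlinarith
    rw [hre] at hn1
    nlinarith [mul_pos (sub_pos.2 h3) (sub_pos.2 h4)]

end Bump

/-! ### The folded ribbon, its ratio and its layering. -/

section Ribbon

/-- The lifted height on panel `i`. -/
noncomputable def panelHeight (n q : ℕ) (i : ℤ) (t s : ℝ) : ℝ :=
  bump n q (panelMap n q i t s) * (t - i * (2 * Real.sin (halfAngle n q)))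

lemma continuous_panelMap (n q : ℕ) (i : ℤ) :
    Continuous fun p : ℝ × ℝ => panelMap n q i p.1 p.2 := by
  unfold panelMap; fun_prop

lemma panelHeight_crease {n q : ℕ} (hq : 2 ≤ q) (hn : 2 * q + 2 ≤ n) (i : ℤ) {s : ℝ}
    (hs : |s| ≤ halfWidth n q) :
    panelHeight n q i (crease n q (i + 1) s) s =
      panelHeight n q (i + 1) (crease n q (i + 1) s) s := by
  rw [panelHeight, panelHeight, panelMap_crease_add_one hq hn i hs,
    bump_eq_zero q (by omega) (dirCoord_panelMap_crease hq hn (i + 1) hs), zero_mul, zero_mul]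

/-- The position of the points of the strip in the plane. -/
noncomputable def position (n q : ℕ) : ℝ → ℝ → ℂ := glue (crease n q) (panelMap n q)

/-- The height of the points of the strip. -/
noncomputable def lift (n q : ℕ) : ℝ → ℝ → ℝ := glue (crease n q) (panelHeight n q)

lemma position_eq {n q : ℕ} (hq : 2 ≤ q) (hn : 2 * q + 2 ≤ n) {i : ℤ} {t s : ℝ}
    (hs : |s| ≤ halfWidth n q) (h0 : crease n q i s ≤ t) (h1 : t ≤ crease n q (i + 1) s) :
    position n q t s = panelMap n q i t s :=
  glue_eq (fun i => crease_lt hq hn i hs) (fun i => panelMap_crease_add_one hq hn i hs) h0 h1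

lemma lift_eq {n q : ℕ} (hq : 2 ≤ q) (hn : 2 * q + 2 ≤ n) {i : ℤ} {t s : ℝ}
    (hs : |s| ≤ halfWidth n q) (h0 : crease n q i s ≤ t) (h1 : t ≤ crease n q (i + 1) s) :
    lift n q t s = panelHeight n q i t s :=
  glue_eq (fun i => crease_lt hq hn i hs) (fun i => panelHeight_crease hq hn i hs) h0 h1

lemma position_add_length {n q : ℕ} (hq : 2 ≤ q) (hn : 2 * q + 2 ≤ n) (hne : Even n) {t s : ℝ}
    (hs : |s| ≤ halfWidth n q) :
    position n q (t + n * (2 * Real.sin (halfAngle n q))) s = position n q t s := by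
  obtain ⟨i, h0, h1⟩ := exists_panel hq hn t hs
  have e := fun i => crease_add_mul (q := q) hne i 1 s
  have e' := panelMap_add_mul (q := q) (by omega : 0 < n) hne i 1 t s
  simp only [Int.cast_one, one_mul] at e e'
  rw [position_eq hq hn hs h0 h1.le, ← e']
  apply position_eq hq hn hs
  · rw [e]; linarith
  · rw [add_right_comm, e]; linarith

lemma lift_add_length {n q : ℕ} (hq : 2 ≤ q) (hn : 2 * q + 2 ≤ n) (hne : Even n) {t s : ℝ}
    (hs : |s| ≤ halfWidth n q) :
    lift n q (t + n * (2 * Real.sin (halfAngle n q))) s = lift n q t s := by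
  obtain ⟨i, h0, h1⟩ := exists_panel hq hn t hs
  have e := fun i => crease_add_mul (q := q) hne i 1 s
  have e' := panelMap_add_mul (q := q) (by omega : 0 < n) hne i 1 t s
  simp only [Int.cast_one, one_mul] at e e'
  rw [lift_eq hq hn hs h0 h1.le,
    lift_eq hq hn hs (i := i + n) (by rw [e]; linarith) (by rw [add_right_comm, e]; linarith),
    panelHeight, panelHeight, e']
  congr 1
  push_cast; ring

/-- The ribbon folded along the sides of a regular `n`-gon, each panel skipping `q` sides. -/
noncomputable def ribbon {n q : ℕ} (hq : 2 ≤ q) (hn : 2 * q + 2 ≤ n) (hne : Even n) :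
    FoldedRibbon where
  width := 2 * halfWidth n q
  length := n * (2 * Real.sin (halfAngle n q))
  width_pos := by linarith [halfWidth_pos hq hn]
  length_pos := by
    have := sin_halfAngle_pos hq hn
    have : (0 : ℝ) < n := by exact_mod_cast (by omega : 0 < n)
    positivity
  numFolds := n
  numFolds_pos := by omega
  -- The shift by 1/2 centres panel `i` at `t = i * (2 sin β)`.
  foldPos i := (i - 1 / 2) * (2 * Real.sin (halfAngle n q))
  foldSlope i := -(sgn i * Real.cot (halfAngle n q))
  foldPos_periodic i := by push_cast; ring
  foldSlope_periodic i := by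
    have := sgn_add_even hne 1 i
    rw [one_mul] at this
    rw [this, hne.neg_one_pow, one_mul]
  folds_ordered i s hs := by
    rw [mul_div_cancel_left₀ _ two_ne_zero] at hs
    exact crease_lt hq hn i hs.le
  toPlane := position n q
  panel_isometry i := by
    refine ⟨cis ((2 * i + 1) * halfAngle n q) * ((Real.cos (halfAngle n q) : ℝ)
      - (i * (2 * Real.sin (halfAngle n q)) : ℝ) * Complex.I),
      cis ((2 * i + 1) * halfAngle n q) * Complex.I, by simp, fun t s hs h0 h1 => ?_⟩
    rw [mul_div_cancel_left₀ _ two_ne_zero] at hs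
    rw [position_eq hq hn hs h0 h1, panelMap, sgn]
    push_cast
    linear_combination
      (-cis ((2 * i + 1) * halfAngle n q) * (-1) ^ i * (s : ℂ)) * Complex.I_mul_I
  toPlane_closed t s hs := by
    rw [mul_div_cancel_left₀ _ two_ne_zero] at hs
    rw [hne.neg_one_pow, one_mul]
    exact position_add_length hq hn hne hs

lemma ribbon_ratio {n q : ℕ} (hq : 2 ≤ q) (hn : 2 * q + 2 ≤ n) (hne : Even n) :
    (ribbon hq hn hne).ratio = n * Real.cot (Real.pi / n) := by
  have hs := (sin_halfAngle_pos hq hn).ne'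
  have h3 : 3 ≤ n := by omega
  have := (sin_pi_div_pos h3).ne'
  have := (cos_pi_div_pos h3).ne'
  rw [FoldedRibbon.ratio]
  simp only [ribbon, halfWidth]
  rw [Real.cot_eq_cos_div_sin, Real.tan_eq_sin_div_cos]
  field_simp

lemma panelMap_re_pos {n q : ℕ} (hq : 2 ≤ q) (hn : 2 * q + 2 ≤ n) (i : ℤ) {s : ℝ}
    (hs : |s| < halfWidth n q) : 0 < Real.cos (halfAngle n q) - sgn i * s := by
  rw [← abs_sgn_mul i] at hs
  linarith [(abs_lt.1 hs).2, halfWidth_le_cos hq hn]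

lemma coprime_dvd {n q : ℕ} (hco : Nat.Coprime n q) {i j : ℤ} (h : (n : ℤ) ∣ q * i - q * j) :
    (n : ℤ) ∣ i - j := by
  rw [← mul_sub] at h
  exact (Nat.isCoprime_iff_coprime.2 hco).dvd_of_dvd_mul_left h

/-- Points of two panels that are rotated by the same angle coincide only if they are glued. -/
lemma glued_of_dvd {n q : ℕ} (hne : Even n) (hn0 : 0 < n) {i j : ℤ} (hd : (n : ℤ) ∣ j - i)
    {t s t' s' : ℝ} (h : panelMap n q i t s = panelMap n q j t' s') :
    ∃ k : ℤ, t' = t + k * (n * (2 * Real.sin (halfAngle n q))) ∧ s' = s := by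
  obtain ⟨m, hm⟩ := hd
  obtain rfl : j = i + m * n := by linarith
  refine ⟨m, ?_⟩
  rw [← panelMap_add_mul hn0 hne i m t s, panelMap, panelMap,
    mul_right_inj' (cis_ne_zero _)] at h
  have h1 := congrArg Complex.re h
  have h2 := congrArg Complex.im h
  simp only [Complex.add_re, Complex.add_im, Complex.ofReal_re, Complex.ofReal_im,
    Complex.re_ofReal_mul, Complex.im_ofReal_mul, Complex.I_re, Complex.I_im] at h1 h2
  have h3 : sgn (i + m * n) * (s' - s) = 0 := by linarith
  have h4 : sgn (i + m * n) ≠ 0 := fun h => by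
    have := sgn_mul_self (i + m * n)
    rw [h] at this; norm_num at this
  constructor
  · linarith
  · linarith [(mul_eq_zero.1 h3).resolve_left h4]

lemma lift_embedded {n q : ℕ} (hq : 2 ≤ q) (hn : 2 * q + 2 ≤ n) (hne : Even n)
    (hco : Nat.Coprime n q) {t s t' s' : ℝ} (hs : |s| < halfWidth n q) (hs' : |s'| < halfWidth n q)
    (hp : position n q t s = position n q t' s') (hl : lift n q t s = lift n q t' s') :
    ∃ k : ℤ, t' = t + k * (n * (2 * Real.sin (halfAngle n q))) ∧ s' = s := by
  have hn0 : 0 < n := by omega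
  obtain ⟨i, i0, i1⟩ := exists_panel hq hn t hs.le
  obtain ⟨j, j0, j1⟩ := exists_panel hq hn t' hs'.le
  rw [position_eq hq hn hs.le i0 i1.le, position_eq hq hn hs'.le j0 j1.le] at hp
  rw [lift_eq hq hn hs.le i0 i1.le, lift_eq hq hn hs'.le j0 j1.le, panelHeight, panelHeight,
    ← hp] at hl
  refine glued_of_dvd hne hn0 ?_ hp
  by_cases hc : ∃ c : ℤ, dirCoord (2 * c * (Real.pi / n)) (panelMap n q i t s) = 1
  -- Over a side, `bump` vanishes and heights carry no information, but the side itself determines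
  -- the crease modulo `n`.
  · obtain ⟨c, hc⟩ := hc
    have d1 := (dvd_of_dirCoord_panelMap_eq hq hn i c hs i0 i1 hc).1
    rw [hp] at hc
    have d2 := (dvd_of_dirCoord_panelMap_eq hq hn j c hs' j0 j1 hc).1
    have := dvd_sub d2 d1
    rw [sub_sub_sub_cancel_right] at this
    exact coprime_dvd hco this
  · push Not at hc
    have hb := bump_pos hq hn fun c =>
      lt_of_le_of_ne (dirCoord_panelMap_le hq hn i c hs.le i0 i1.le) (hc c)
    have hx := mul_left_cancel₀ hb.ne' hl
    have y0 := panelMap_re_pos hq hn i hs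
    have y1 := panelMap_re_pos hq hn j hs'
    have hnorm := congrArg (fun z : ℂ => ‖z‖ ^ 2) hp
    simp only [panelMap, hx, norm_mul, norm_cis, one_mul, Complex.sq_norm,
      Complex.normSq_add_mul_I] at hnorm
    -- Equal norms and equal coordinates along the panels give equal squares; both numbers are
    -- positive.
    have hy : Real.cos (halfAngle n q) - sgn i * s = Real.cos (halfAngle n q) - sgn j * s' := by
      nlinarith
    have hp' := hp
    rw [panelMap, panelMap, hx, hy] at hp'
    have hz : (((Real.cos (halfAngle n q) - sgn j * s' : ℝ) : ℂ)
        + (t' - j * (2 * Real.sin (halfAngle n q)) : ℝ) * Complex.I) ≠ 0 := fun h => by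
      have := congrArg Complex.re h
      simp only [Complex.add_re, Complex.ofReal_re, Complex.re_ofReal_mul, Complex.I_re,
        mul_zero, add_zero, Complex.zero_re] at this
      linarith
    -- The unrotated points agree and are nonzero, so the rotations agree: 2(i - j)β is a multiple
    -- of 2π.
    obtain ⟨m, hm⟩ := cis_eq_cis_iff.1 (mul_right_cancel₀ hz hp')
    apply coprime_dvd hco
    refine ⟨-m, ?_⟩
    have hn' : (n : ℝ) ≠ 0 := by positivity
    rw [halfAngle] at hm
    field_simp at hm
    have : (q : ℝ) * j - q * i = n * -m := by linarith
    exact_mod_cast this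

/-- The layering of the ribbon by its lifted height. -/
noncomputable def layering {n q : ℕ} (hq : 2 ≤ q) (hn : 2 * q + 2 ≤ n) (hne : Even n)
    (hco : Nat.Coprime n q) : (ribbon hq hn hne).Layering where
  height := lift n q
  height_continuous := by
    have h : (ribbon hq hn hne).width / 2 = halfWidth n q := mul_div_cancel_left₀ _ two_ne_zero
    rw [h]
    refine continuousOn_strip hq hn (F := panelHeight n q) (fun i => ?_)
      fun i t s hs h0 h1 => lift_eq hq hn hs h0 h1
    exact ((continuous_bump n q).comp (continuous_panelMap n q i)).mul (by fun_prop)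
  height_closed t s hs := by
    have h : (ribbon hq hn hne).width / 2 = halfWidth n q := mul_div_cancel_left₀ _ two_ne_zero
    rw [h] at hs
    have h' : (-1 : ℝ) ^ (ribbon hq hn hne).numFolds = 1 := hne.neg_one_pow
    rw [h', one_mul]
    exact lift_add_length hq hn hne hs.le
  embedded t s t' s' hs hs' hp hl := by
    have h : (ribbon hq hn hne).width / 2 = halfWidth n q := mul_div_cancel_left₀ _ two_ne_zero
    rw [h] at hs hs'
    have h' : (-1 : ℝ) ^ (ribbon hq hn hne).numFolds = 1 := hne.neg_one_pow
    simp only [h', one_zpow, one_mul]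
    exact lift_embedded hq hn hne hco hs hs' hp hl

end Ribbon

/-! ### The creases are the sides, and the ribbon lies in the polygon. -/

section Polygon

lemma regularVertex_eq_vert {n : ℕ} (k : ℤ) :
    regularVertex n 0 (vert n 0) k = vert n k := by
  have h : Complex.exp (2 * Real.pi * Complex.I * k / n) = cis (2 * k * (Real.pi / n)) := by
    rw [cis]; congr 1; push_cast; ring
  rw [regularVertex, h, zero_add, vert, vert, mul_assoc, ← cis_add]
  congr 2
  push_cast; ring

lemma vert_add_mul {n : ℕ} (hn : 0 < n) (c m : ℤ) : vert n (c + n * m) = vert n c := by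
  have hn' : (n : ℝ) ≠ 0 := by positivity
  rw [vert, vert]
  congr 1
  refine cis_eq_cis_iff.2 ⟨m, ?_⟩
  push_cast; field_simp; ring

lemma foldLine_ribbon {n q : ℕ} (hq : 2 ≤ q) (hn : 2 * q + 2 ≤ n) (hne : Even n) (i : ℤ) :
    (ribbon hq hn hne).foldLine i = segment ℝ (vert n (q * i)) (vert n (q * i + 1)) := by
  have hw : (ribbon hq hn hne).width / 2 = halfWidth n q := mul_div_cancel_left₀ _ two_ne_zero
  have key : ∀ s, |s| ≤ halfWidth n q → (ribbon hq hn hne).toPlane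
      ((ribbon hq hn hne).foldPos i + (ribbon hq hn hne).foldSlope i * s) s =
      across n q i s • vert n (q * i) + (1 - across n q i s) • vert n (q * i + 1) := fun s hs => by
    have := panelMap_crease hq hn i hs
    rw [← position_eq hq hn hs le_rfl (crease_lt hq hn i hs).le, add_comm, sub_sub_cancel] at this
    simp only [Complex.real_smul]
    exact this
  ext z
  simp only [FoldedRibbon.foldLine, Set.mem_ofPred_eq, hw, segment]
  constructor
  · rintro ⟨s, hs, rfl⟩
    obtain ⟨a0, a1⟩ := across_mem hq hn i hs
    exact ⟨_, _, a0, sub_nonneg.2 a1, by ring, (key s hs).symm⟩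
  · rintro ⟨a, b, ha, hb, hab, rfl⟩
    have hwp := halfWidth_pos hq hn
    have hs : |sgn i * ((2 * a - 1) * halfWidth n q)| ≤ halfWidth n q := by
      rw [abs_sgn_mul, abs_mul, abs_of_pos hwp]
      have : |2 * a - 1| ≤ 1 := abs_le.2 ⟨by linarith, by linarith⟩
      nlinarith
    refine ⟨_, hs, ?_⟩
    have : across n q i (sgn i * ((2 * a - 1) * halfWidth n q)) = a := by
      rw [across, ← mul_assoc, sgn_mul_self, one_mul, mul_div_cancel_right₀ _ hwp.ne']; ring
    rw [key _ hs, this, ← hab]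
    congr 2; ring

lemma image_ribbon_subset {n q : ℕ} (hq : 2 ≤ q) (hn : 2 * q + 2 ≤ n) (hne : Even n) :
    (ribbon hq hn hne).image ⊆ convexHull ℝ (Set.range (vert n)) := by
  rintro z ⟨t, s, hs, rfl⟩
  have hw : (ribbon hq hn hne).width / 2 = halfWidth n q := mul_div_cancel_left₀ _ two_ne_zero
  rw [hw] at hs
  obtain ⟨i, h0, h1⟩ := exists_panel hq hn t hs
  have e : (ribbon hq hn hne).toPlane t s = panelMap n q i t s := position_eq hq hn hs h0 h1.le
  rw [e, panelMap_eq_vert hq hn i t hs]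
  rw [← neg_one_le_along_iff hq hn i hs] at h0
  have h2 := (along_le_one_iff hq hn i hs).2 h1.le
  obtain ⟨a0, a1⟩ := across_mem hq hn i hs
  have hv : ∀ c, vert n c ∈ convexHull ℝ (Set.range (vert n)) :=
    fun c => subset_convexHull ℝ _ ⟨c, rfl⟩
  have hcv := convex_convexHull ℝ (Set.range (vert n))
  have hside : ∀ c c', ((across n q i s : ℝ) : ℂ) * vert n c
      + (1 - across n q i s : ℝ) * vert n c' ∈ convexHull ℝ (Set.range (vert n)) := fun c c' => by
    simpa only [Complex.real_smul] using
      hcv (hv c) (hv c') a0 (sub_nonneg.2 a1) (add_sub_cancel _ _)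
  simpa only [Complex.real_smul] using hcv (hside (q * (i + 1) + 1) (q * (i + 1)))
    (hside (q * i) (q * i + 1)) (a := (1 + along n q i t s) / 2) (b := (1 - along n q i t s) / 2)
    (by linarith) (by linarith) (by ring)

lemma ribbon_formsRegularPolygon {n q : ℕ} (hq : 2 ≤ q) (hn : 2 * q + 2 ≤ n) (hne : Even n)
    (hco : Nat.Coprime n q) : (ribbon hq hn hne).FormsRegularPolygon n := by
  have hv : regularVertex n 0 (vert n 0) = vert n := funext regularVertex_eq_vert
  refine ⟨rfl, 0, vert n 0, ?_, ?_, ?_⟩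
  · have := (cos_pi_div_pos (by omega : 3 ≤ n)).ne'
    exact mul_ne_zero (by exact_mod_cast one_div_ne_zero this) (cis_ne_zero _)
  · rw [hv]
    ext S
    constructor
    · rintro ⟨i, rfl⟩
      exact ⟨q * i, (foldLine_ribbon hq hn hne i).symm⟩
    · rintro ⟨k, rfl⟩
      -- In this Bézout relation `b` inverts `q` modulo `n`, so crease `b * k` lies on side `k`.
      obtain ⟨a, b, hab⟩ := Nat.isCoprime_iff_coprime.2 hco
      refine ⟨b * k, ?_⟩
      have e : (q : ℤ) * (b * k) = k + n * (-(a * k)) := by linear_combination k * hab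
      simp only [foldLine_ribbon, e]
      rw [add_right_comm, vert_add_mul (by omega), vert_add_mul (by omega)]
  · rw [hv]
    exact image_ribbon_subset hq hn hne

end Polygon

/-! ### Ambient isotopies from rotations and radial rescalings about the axis. -/

section Isotopy

lemma ambientIsotopic_trans {K K' K'' : Set Space3} (h : AmbientIsotopic K K')
    (h' : AmbientIsotopic K' K'') : AmbientIsotopic K K'' := by
  obtain ⟨H, hc, h0, h1⟩ := h
  obtain ⟨G, gc, g0, g1⟩ := h'
  refine ⟨fun τ => (H τ).trans (G τ), ?_, fun x => by simp [h0, g0], ?_⟩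
  · exact gc.comp (continuous_fst.prodMk hc)
  · rw [← g1, ← h1, Set.image_image]; rfl

/-- Rotation about the vertical axis, by an angle depending on the distance from the axis and on
the height. -/
noncomputable def twist (α : ℝ → ℝ → ℝ) (x : Space3) : Space3 :=
  (x.1 * cis (α ‖x.1‖ x.2), x.2)

lemma continuous_twist {Y : Type*} [TopologicalSpace Y] {α : Y → ℝ → ℝ → ℝ}
    (hα : Continuous fun y : Y × ℝ × ℝ => α y.1 y.2.1 y.2.2) :
    Continuous fun y : Y × Space3 => twist (α y.1) y.2 := by
  have h : Continuous fun y : Y × Space3 => α y.1 ‖y.2.1‖ y.2.2 :=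
    hα.comp (by fun_prop : Continuous fun y : Y × Space3 => (y.1, ‖y.2.1‖, y.2.2))
  have := continuous_cis.comp h
  exact ((continuous_fst.comp continuous_snd).mul this).prodMk (by fun_prop)

lemma twist_twist_neg (α β : ℝ → ℝ → ℝ) (h : ∀ a b, α a b + β a b = 0) (x : Space3) :
    twist α (twist β x) = x := by
  ext1
  · simp only [twist, norm_mul, norm_cis, mul_one]
    rw [mul_assoc, ← cis_add, add_comm, h, cis_zero, mul_one]
  · rfl

lemma ambientIsotopic_twist {α : ℝ → ℝ → ℝ} (hα : Continuous fun y : ℝ × ℝ => α y.1 y.2)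
    (K : Set Space3) : AmbientIsotopic K (twist α '' K) := by
  have hc : Continuous fun y : ℝ × Space3 => twist (fun a b => y.1 * α a b) y.2 :=
    continuous_twist (α := fun (τ : ℝ) a b => τ * α a b)
      (continuous_fst.mul (hα.comp continuous_snd))
  have hc' : ∀ τ : ℝ, Continuous (twist fun a b => τ * α a b) := fun τ =>
    hc.comp (by fun_prop : Continuous fun x : Space3 => (τ, x))
  refine ⟨fun τ =>
    { toFun := twist fun a b => (τ : ℝ) * α a b
      invFun := twist fun a b => -(τ : ℝ) * α a b
      left_inv := twist_twist_neg _ _ fun a b => by ring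
      right_inv := twist_twist_neg _ _ fun a b => by ring
      continuous_toFun := hc' _
      continuous_invFun := hc' _ }, ?_, fun x => ?_, ?_⟩
  · exact hc.comp (by fun_prop : Continuous fun p : unitInterval × Space3 => ((p.1 : ℝ), p.2))
  · change twist (fun a b => ((0 : unitInterval) : ℝ) * α a b) x = x
    simp [twist]
  · change twist (fun a b => ((1 : unitInterval) : ℝ) * α a b) '' K = _
    simp

/-- Radial rescaling by a factor that depends on the distance from the vertical axis. -/
noncomputable def stretch (σ : ℝ → ℝ) (x : Space3) : Space3 := ((σ ‖x.1‖ : ℂ) * x.1, x.2)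

/-- Directions are kept, so only a ↦ σ(a) a on radii matters: monotonicity gives injectivity, and
the bound σ ≥ m with the intermediate value theorem gives surjectivity. -/
lemma stretch_bijective {σ : ℝ → ℝ} (hσ : Continuous σ) {m : ℝ} (hm : 0 < m)
    (hlow : ∀ a, m ≤ σ a) (hmono : StrictMonoOn (fun a => σ a * a) (Set.Ici 0)) :
    Function.Bijective (stretch σ) := by
  have hpos : ∀ a, 0 < σ a := fun a => hm.trans_le (hlow a)
  constructor
  · intro x y h
    have h1 : (σ ‖x.1‖ : ℂ) * x.1 = (σ ‖y.1‖ : ℂ) * y.1 := congrArg Prod.fst h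
    have h2 : (stretch σ x).2 = (stretch σ y).2 := congrArg Prod.snd h
    have h3 := congrArg norm h1
    simp only [norm_mul, Complex.norm_real, Real.norm_eq_abs, abs_of_pos (hpos _)] at h3
    have h4 := hmono.injOn (norm_nonneg x.1) (norm_nonneg y.1) h3
    rw [h4] at h1
    exact Prod.ext (mul_left_cancel₀ (by exact_mod_cast (hpos _).ne') h1) h2
  · intro y
    have hc : ContinuousOn (fun a => σ a * a) (Set.Icc 0 (‖y.1‖ / m)) := by fun_prop
    have hle : ‖y.1‖ ≤ σ (‖y.1‖ / m) * (‖y.1‖ / m) := by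
      have h0 : 0 ≤ ‖y.1‖ / m := by positivity
      calc ‖y.1‖ = m * (‖y.1‖ / m) := by field_simp
        _ ≤ _ := mul_le_mul_of_nonneg_right (hlow _) h0
    obtain ⟨a, ha, hay⟩ := intermediate_value_Icc (by positivity) hc
      (show ‖y.1‖ ∈ Set.Icc (σ 0 * 0) _ from ⟨by simp, hle⟩)
    have hay : σ a * a = ‖y.1‖ := hay
    have hn : ‖((σ a)⁻¹ : ℂ) * y.1‖ = a := by
      rw [norm_mul, ← hay, norm_inv, Complex.norm_real, Real.norm_eq_abs, abs_of_pos (hpos a),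
        inv_mul_cancel_left₀ (hpos a).ne']
    refine ⟨(((σ a)⁻¹ : ℂ) * y.1, y.2), Prod.ext ?_ rfl⟩
    change (σ ‖((σ a)⁻¹ : ℂ) * y.1‖ : ℂ) * (((σ a)⁻¹ : ℂ) * y.1) = y.1
    rw [hn, mul_inv_cancel_left₀ (by exact_mod_cast (hpos a).ne')]

lemma continuous_stretch {σ : ℝ → ℝ} (hσ : Continuous σ) : Continuous (stretch σ) := by
  unfold stretch
  exact ((Complex.continuous_ofReal.comp (hσ.comp (by fun_prop))).mul continuous_fst).prodMk
    continuous_snd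

/-- Norms shrink at most by the factor min(m, 1), so the map is proper. This makes the inverse
continuous. -/
lemma isClosedMap_stretch {σ : ℝ → ℝ} (hσ : Continuous σ) {m : ℝ} (hm : 0 < m)
    (hlow : ∀ a, m ≤ σ a) : IsClosedMap (stretch σ) := by
  refine (isProperMap_iff_tendsto_cocompact.2 ⟨continuous_stretch hσ, ?_⟩).isClosedMap
  rw [← Metric.cobounded_eq_cocompact, ← tendsto_norm_atTop_iff_cobounded]
  have h1 : Filter.Tendsto (fun x : Space3 => min m 1 * ‖x‖) (Bornology.cobounded Space3)
      Filter.atTop := tendsto_norm_cobounded_atTop.const_mul_atTop (by positivity)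
  refine Filter.tendsto_atTop_mono (fun x => ?_) h1
  have hp : 0 < σ ‖x.1‖ := hm.trans_le (hlow _)
  rw [Prod.norm_def, Prod.norm_def, mul_max_of_nonneg _ _ (by positivity)]
  refine max_le_max ?_ ?_
  · change _ ≤ ‖(σ ‖x.1‖ : ℂ) * x.1‖
    rw [norm_mul, Complex.norm_real, Real.norm_eq_abs, abs_of_pos hp]
    exact mul_le_mul_of_nonneg_right ((min_le_left _ _).trans (hlow _)) (norm_nonneg _)
  · exact mul_le_of_le_one_left (norm_nonneg _) (min_le_right _ _)

/-- A radial rescaling as a homeomorphism. -/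
noncomputable def stretchHomeo {σ : ℝ → ℝ} (hσ : Continuous σ) {m : ℝ} (hm : 0 < m)
    (hlow : ∀ a, m ≤ σ a) (hmono : StrictMonoOn (fun a => σ a * a) (Set.Ici 0)) :
    Space3 ≃ₜ Space3 :=
  (Equiv.ofBijective _ (stretch_bijective hσ hm hlow hmono)).toHomeomorphOfContinuousClosed
    (continuous_stretch hσ) (isClosedMap_stretch hσ hm hlow)

/-- The isotopy interpolates linearly between the factors 1 and σ; this keeps both the lower bound
`m` and the monotonicity. -/
lemma ambientIsotopic_stretch {σ : ℝ → ℝ} (hσ : Continuous σ) {m : ℝ} (hm : 0 < m) (hm1 : m ≤ 1)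
    (hlow : ∀ a, m ≤ σ a) (hmono : StrictMonoOn (fun a => σ a * a) (Set.Ici 0))
    (K : Set Space3) : AmbientIsotopic K (stretch σ '' K) := by
  have hτ : ∀ τ : unitInterval, StrictMonoOn (fun a => ((1 - τ : ℝ) + τ * σ a) * a)
      (Set.Ici 0) := by
    rintro ⟨τ, t0, t1⟩ a ha b hb hab
    have h1 := hmono ha hb hab
    simp only at h1 ⊢
    rcases t0.eq_or_lt with rfl | t0
    · simpa using hab
    · nlinarith
  refine ⟨fun τ => stretchHomeo (σ := fun a => (1 - τ : ℝ) + τ * σ a) (by fun_prop) hm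
    (fun a => by nlinarith [hlow a, τ.2.1, τ.2.2]) (hτ τ), ?_, fun x => ?_, ?_⟩
  · change Continuous fun p : unitInterval × Space3 =>
      stretch (fun a => (1 - p.1 : ℝ) + p.1 * σ a) p.2
    unfold stretch
    fun_prop
  · change stretch (fun a => (1 - ((0 : unitInterval) : ℝ)) + ((0 : unitInterval) : ℝ) * σ a) x = x
    simp [stretch]
  · change stretch (fun a => (1 - ((1 : unitInterval) : ℝ)) + ((1 : unitInterval) : ℝ) * σ a) '' K
      = _
    simp

end Isotopy

/-! ### Extending a function on the circle to the plane. -/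

section PeriodicExtension

/-- A function of the argument, scaled to be continuous at the origin. -/
noncomputable def angular (Φ : ℝ → ℝ) (w : ℂ) : ℝ := ‖w‖ * Φ w.arg

/-- Equal end values let `Φ` descend to the circle, which removes the jump of `arg` on the negative
axis; at 0 the factor ‖w‖ wins against the bounded `Φ`. -/
lemma continuous_angular {Φ : ℝ → ℝ} (hΦ : Continuous Φ) (h : Φ (-Real.pi) = Φ Real.pi) :
    Continuous (angular Φ) := by
  obtain ⟨C, hC⟩ := isCompact_Icc.exists_bound_of_continuousOn
    (hΦ.continuousOn (s := Set.Icc (-Real.pi) Real.pi))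
  have : Fact (0 < 2 * Real.pi) := ⟨Real.two_pi_pos⟩
  have e : -Real.pi + 2 * Real.pi = Real.pi := by ring
  have hlift : Continuous (AddCircle.liftIco (2 * Real.pi) (-Real.pi) Φ) :=
    AddCircle.liftIco_continuous (by rw [e, h]) hΦ.continuousOn
  have hval : ∀ w : ℂ, AddCircle.liftIco (2 * Real.pi) (-Real.pi) Φ (w.arg : Real.Angle)
      = Φ w.arg := fun w => by
    rcases (Complex.arg_le_pi w).eq_or_lt with hw | hw
    · have h1 : ((Real.pi : ℝ) : Real.Angle) = ((-Real.pi : ℝ) : Real.Angle) :=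
        (Real.Angle.angle_eq_iff_two_pi_dvd_sub).2 ⟨1, by push_cast; ring⟩
      rw [hw, h1, ← h]
      exact AddCircle.liftIco_coe_apply ⟨le_rfl, by rw [e]; linarith [Real.pi_pos]⟩
    · exact AddCircle.liftIco_coe_apply ⟨(Complex.neg_pi_lt_arg w).le, by rwa [e]⟩
  rw [continuous_iff_continuousAt]
  intro w
  by_cases hw : w = 0
  · subst hw
    have hb : ∀ w : ℂ, ‖angular Φ w‖ ≤ ‖w‖ * C := fun w => by
      rw [angular, norm_mul, norm_norm]
      exact mul_le_mul_of_nonneg_left (hC _ ⟨(Complex.neg_pi_lt_arg w).le, Complex.arg_le_pi w⟩)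
        (norm_nonneg _)
    have h0 : angular Φ 0 = 0 := by simp [angular]
    rw [ContinuousAt, h0]
    refine squeeze_zero_norm hb ?_
    have : Continuous fun w : ℂ => ‖w‖ * C := by fun_prop
    simpa using this.tendsto 0
  · have h1 : ContinuousAt (fun w : ℂ => ‖w‖ *
        AddCircle.liftIco (2 * Real.pi) (-Real.pi) Φ (w.arg : Real.Angle)) w :=
      continuous_norm.continuousAt.mul
        (hlift.continuousAt.comp (Complex.continuousAt_arg_coe_angle hw))
    refine h1.congr (Filter.Eventually.of_forall fun v => ?_)
    simp only [angular, hval]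

lemma angular_cis {Φ : ℝ → ℝ} (h : Φ (-Real.pi) = Φ Real.pi) {u : ℝ} (h0 : -Real.pi ≤ u)
    (h1 : u ≤ Real.pi) : angular Φ (cis u) = Φ u := by
  rw [angular, norm_cis, one_mul]
  rcases h0.eq_or_lt with rfl | h0
  · rw [cis]
    simp [h]
  · rw [cis, Complex.arg_exp_mul_I, (toIocMod_eq_self Real.two_pi_pos).2]
    exact ⟨h0, by linarith⟩

end PeriodicExtension

/-! ### The radial rescaling that brings the centre line to the torus. -/

section RadialFactor

/-- The radial factor that takes the distances between `cos b` and `1` to those between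
`1` and `3`. -/
noncomputable def radialFactor (b a : ℝ) : ℝ :=
  (1 + 2 * (max (Real.cos b) (min 1 a) ^ 2 - Real.cos b ^ 2) / Real.sin b ^ 2) /
    max (Real.cos b) (min 1 a)

lemma continuous_radialFactor {b : ℝ} (hc : 0 < Real.cos b) : Continuous (radialFactor b) := by
  unfold radialFactor
  refine Continuous.div (by fun_prop) (by fun_prop) fun a => ?_
  exact (hc.trans_le (le_max_left _ _)).ne'

lemma one_le_radialFactor {b : ℝ} (hc : 0 < Real.cos b) (a : ℝ) : 1 ≤ radialFactor b a := by
  have h0 : Real.cos b ≤ max (Real.cos b) (min 1 a) := le_max_left _ _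
  have h1 : max (Real.cos b) (min 1 a) ≤ 1 := max_le (Real.cos_le_one b) (min_le_left _ _)
  rw [radialFactor, one_le_div (hc.trans_le h0)]
  have : 0 ≤ 2 * (max (Real.cos b) (min 1 a) ^ 2 - Real.cos b ^ 2) / Real.sin b ^ 2 := by
    apply div_nonneg _ (sq_nonneg _)
    nlinarith
  linarith

/-- With c(a) the value of a clamped to [cos b, 1], the function is N(a) · (a / c(a)). Both factors
are nondecreasing; the second increases strictly where c is constant, the first where c grows. -/
lemma strictMonoOn_radialFactor {b : ℝ} (hc : 0 < Real.cos b) (hs : 0 < Real.sin b) :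
    StrictMonoOn (fun a => radialFactor b a * a) (Set.Ici 0) := by
  intro a ha a' _ haa
  have ha : 0 ≤ a := ha
  have hd1 := Real.cos_le_one b
  set d := Real.cos b
  set c : ℝ → ℝ := fun a => max d (min 1 a) with hcdef
  set N : ℝ → ℝ := fun a => 1 + 2 * (c a ^ 2 - d ^ 2) / Real.sin b ^ 2 with hN
  have hcpos : ∀ a, 0 < c a := fun a => hc.trans_le (le_max_left _ _)
  have hNpos : ∀ a, 0 < N a := fun a => by
    have h0 : d ≤ c a := le_max_left _ _
    have : 0 ≤ 2 * (c a ^ 2 - d ^ 2) / Real.sin b ^ 2 :=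
      div_nonneg (by nlinarith) (sq_nonneg _)
    simp only [hN]; linarith
  have hr : ∀ a, radialFactor b a * a = N a * (a / c a) := fun a => by
    simp only [radialFactor, hN, hcdef, d]; ring
  simp only [hr]
  have hmono : c a ≤ c a' := max_le_max le_rfl (min_le_min le_rfl haa.le)
  rcases hmono.eq_or_lt with h | h
  · have hNe : N a = N a' := by simp only [hN, h]
    rw [hNe, h]
    exact mul_lt_mul_of_pos_left (div_lt_div_of_pos_right haa (hcpos _)) (hNpos _)
  · have h1 : a / c a ≤ a' / c a' := by
      rw [div_le_div_iff₀ (hcpos _) (hcpos _)]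
      have hle : d < a' → c a' ≤ a' := fun h => max_le h.le (min_le_right _ _)
      rcases le_or_gt a d with had | had
      · have e : c a = d := max_eq_left ((min_le_right _ _).trans had)
        rw [e]
        rcases le_or_gt a' d with had' | had'
        · rw [show c a' = d from max_eq_left ((min_le_right _ _).trans had')]
          nlinarith
        · nlinarith [hle had', hcpos a']
      · rcases le_or_gt 1 a with h1a | h1a
        · have e : c a = 1 := by simp only [hcdef, min_eq_left h1a, max_eq_right hd1]
          have e' : c a' = 1 := by
            simp only [hcdef, min_eq_left (h1a.trans haa.le), max_eq_right hd1]
          rw [e, e'] at h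
          exact absurd h (lt_irrefl _)
        · have e : c a = a := by simp only [hcdef, min_eq_right h1a.le, max_eq_right had.le]
          rw [e, mul_comm a']
          exact mul_le_mul_of_nonneg_left (hle (had.trans haa)) ha
    have h2 : N a < N a' := by
      simp only [hN]
      gcongr
    calc N a * (a / c a) ≤ N a * (a' / c a') := mul_le_mul_of_nonneg_left h1 (hNpos _).le
      _ < N a' * (a' / c a') := mul_lt_mul_of_pos_right h2 (div_pos (ha.trans_lt haa) (hcpos _))

lemma radialFactor_mul {b a : ℝ} (h0 : Real.cos b ≤ a) (h1 : a ≤ 1) (ha : 0 < a) :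
    radialFactor b a * a = 1 + 2 * (a ^ 2 - Real.cos b ^ 2) / Real.sin b ^ 2 := by
  rw [radialFactor, min_eq_right h1, max_eq_right h0, div_mul_cancel₀ _ ha.ne']

end RadialFactor

/-! ### The lifted centre line becomes the torus knot. -/

section Core

/-- A point of the lifted centre line. -/
noncomputable def corePoint (n q : ℕ) (i : ℤ) (u : ℝ) : Space3 :=
  (cis ((2 * i + 1) * halfAngle n q) * ((Real.cos (halfAngle n q) : ℝ) +
    (Real.sin (halfAngle n q) * Real.sin (u / 2) : ℝ) * Complex.I), Real.sin u)

lemma sq_norm_corePoint (n q : ℕ) (i : ℤ) (u : ℝ) :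
    ‖(corePoint n q i u).1‖ ^ 2 =
      Real.cos (halfAngle n q) ^ 2 + (Real.sin (halfAngle n q) * Real.sin (u / 2)) ^ 2 := by
  rw [corePoint, norm_mul, norm_cis, one_mul, Complex.sq_norm, Complex.normSq_add_mul_I]

/-- The squared chord factor kills the product, the root is sin β cos(u/2), and the constant 2/sin²β
turns the result into the double-angle formula. -/
lemma bump_corePoint {n q : ℕ} (hq : 2 ≤ q) (hn : 2 * q + 2 ≤ n) (i : ℤ) {u : ℝ}
    (h0 : -Real.pi ≤ u) (h1 : u ≤ Real.pi) :
    bump n q (corePoint n q i u).1 * (Real.sin (halfAngle n q) * Real.sin (u / 2))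
      = Real.sin u := by
  have hs := sin_halfAngle_pos hq hn
  obtain ⟨k, hk, e⟩ := exists_range_dirCoord (by omega : 0 < n) (q * i)
  have hz : dirCoord (2 * (k : ℝ) * (Real.pi / n) + halfAngle n q) (corePoint n q i u).1
      = Real.cos (halfAngle n q) := by
    rw [e, corePoint, dirCoord_cis_mul,
      show 2 * ((q * i : ℤ) : ℝ) * (Real.pi / n) + halfAngle n q - (2 * i + 1) * halfAngle n q = 0 by
        rw [halfAngle]; push_cast; ring]
    simp only [dirCoord, Real.cos_zero, Real.sin_zero, Complex.add_re, Complex.ofReal_re,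
      Complex.re_ofReal_mul, Complex.I_re, mul_zero, mul_one, add_zero]
  have hc : 0 ≤ Real.cos (u / 2) :=
    Real.cos_nonneg_of_neg_pi_div_two_le_of_le (by linarith) (by linarith)
  have hsq : 1 - ‖(corePoint n q i u).1‖ ^ 2
      = (Real.sin (halfAngle n q) * Real.cos (u / 2)) ^ 2 := by
    rw [sq_norm_corePoint]
    linear_combination (-1 : ℝ) * Real.sin_sq_add_cos_sq (halfAngle n q) -
      Real.sin (halfAngle n q) ^ 2 * Real.sin_sq_add_cos_sq (u / 2)
  rw [bump, Finset.prod_eq_zero hk (by rw [hz]; simp), add_zero, hsq,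
    Real.sqrt_sq (mul_nonneg hs.le hc)]
  have h2 : Real.sin u = 2 * Real.sin (u / 2) * Real.cos (u / 2) := by
    rw [← Real.sin_two_mul]; congr 1; ring
  rw [h2]; field_simp

lemma core_layering {n q : ℕ} (hq : 2 ≤ q) (hn : 2 * q + 2 ≤ n) (hne : Even n)
    (hco : Nat.Coprime n q) : (layering hq hn hne hco).core =
      {x | ∃ (i : ℤ) (u : ℝ), u ∈ Set.Icc (-Real.pi) Real.pi ∧ corePoint n q i u = x} := by
  have hs := sin_halfAngle_pos hq hn
  have hw : |(0 : ℝ)| ≤ halfWidth n q := by rw [abs_zero]; exact (halfWidth_pos hq hn).le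
  have key : ∀ (i : ℤ) (u : ℝ), u ∈ Set.Icc (-Real.pi) Real.pi → ∀ t : ℝ,
      t - i * (2 * Real.sin (halfAngle n q)) = Real.sin (halfAngle n q) * Real.sin (u / 2) →
      (position n q t 0, lift n q t 0) = corePoint n q i u := by
    intro i u hu t ht
    have b0 := Real.neg_one_le_sin (u / 2)
    have b1 := Real.sin_le_one (u / 2)
    have h0 : crease n q i 0 ≤ t := by
      rw [crease_eq]; simp only [mul_zero, zero_mul, add_zero]; nlinarith
    have h1 : t ≤ crease n q (i + 1) 0 := by
      rw [crease_add_one]; simp only [mul_zero, zero_mul, add_zero]; nlinarith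
    have hp : panelMap n q i t 0 = (corePoint n q i u).1 := by
      rw [panelMap, ht, mul_zero, sub_zero, corePoint]
    rw [position_eq hq hn hw h0 h1, lift_eq hq hn hw h0 h1, panelHeight, hp, ht,
      bump_corePoint hq hn i hu.1 hu.2]
    rfl
  ext x
  constructor
  · rintro ⟨t, rfl⟩
    obtain ⟨i, h0, h1⟩ := exists_panel hq hn t hw
    rw [crease_eq] at h0
    rw [crease_add_one] at h1
    simp only [mul_zero, zero_mul, add_zero] at h0 h1
    set y := (t - i * (2 * Real.sin (halfAngle n q))) / Real.sin (halfAngle n q) with hy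
    have y0 : -1 ≤ y := by rw [hy, le_div_iff₀ hs]; linarith
    have y1 : y ≤ 1 := by rw [hy, div_le_iff₀ hs]; linarith
    have a0 := Real.neg_pi_div_two_le_arcsin y
    have a1 := Real.arcsin_le_pi_div_two y
    have hu : 2 * Real.arcsin y ∈ Set.Icc (-Real.pi) Real.pi := ⟨by linarith, by linarith⟩
    refine ⟨i, 2 * Real.arcsin y, hu, (key i _ hu t ?_).symm⟩
    rw [mul_div_cancel_left₀ _ two_ne_zero, Real.sin_arcsin y0 y1, hy, mul_div_cancel₀ _ hs.ne']
  · rintro ⟨i, u, hu, rfl⟩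
    exact ⟨i * (2 * Real.sin (halfAngle n q)) + Real.sin (halfAngle n q) * Real.sin (u / 2),
      key i u hu _ (by ring)⟩

/-- One turn around the meridian corresponds to one chord. The shift by π puts u = ±π on the outer
equator, where the ends of the chords go. -/
lemma torusKnot_eq {n q : ℕ} (hn : 0 < n) : torusKnot n q =
    {x | ∃ (i : ℤ) (u : ℝ), u ∈ Set.Icc (-Real.pi) Real.pi ∧
      (((2 - Real.cos u : ℝ) : ℂ) * cis ((2 * i + 1) * halfAngle n q + q / n * u),
        Real.sin u) = x} := by
  have hn' : (n : ℝ) ≠ 0 := by positivity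
  have key : ∀ (i : ℤ) (u t : ℝ), n * t = u + Real.pi + i * (2 * Real.pi) →
      ((((2 + Real.cos (n * t) : ℝ) : ℂ) * Complex.exp (((q * t : ℝ) : ℂ) * Complex.I),
        -Real.sin (n * t)) : Space3) =
      (((2 - Real.cos u : ℝ) : ℂ) * cis ((2 * i + 1) * halfAngle n q + q / n * u),
        Real.sin u) := by
    intro i u t h
    have ht : q * t = (2 * i + 1) * halfAngle n q + q / n * u := by
      have : t = (u + Real.pi + i * (2 * Real.pi)) / n := by rw [← h]; field_simp
      rw [this, halfAngle]; ring
    rw [h, ht, Real.cos_add_int_mul_two_pi, Real.sin_add_int_mul_two_pi, Real.cos_add_pi,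
      Real.sin_add_pi, neg_neg, ← sub_eq_add_neg]
    rfl
  ext x
  constructor
  · rintro ⟨t, rfl⟩
    have hp := Real.two_pi_pos
    have f0 := Int.floor_le (n * t / (2 * Real.pi))
    have f1 := Int.lt_floor_add_one (n * t / (2 * Real.pi))
    rw [le_div_iff₀ hp] at f0
    rw [div_lt_iff₀ hp] at f1
    exact ⟨⌊n * t / (2 * Real.pi)⌋, n * t - Real.pi - ⌊n * t / (2 * Real.pi)⌋ * (2 * Real.pi),
      ⟨by linarith, by linarith⟩, (key _ _ t (by ring)).symm⟩
  · rintro ⟨i, u, -, rfl⟩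
    exact ⟨(u + Real.pi + i * (2 * Real.pi)) / n, key i u _ (mul_div_cancel₀ _ hn')⟩

/-- The difference of the angles along the torus knot and along a chord. -/
noncomputable def angleShift (n q : ℕ) (u : ℝ) : ℝ :=
  q / n * u - Real.arctan (Real.tan (halfAngle n q) * Real.sin (u / 2))

lemma angleShift_neg_pi (n q : ℕ) : angleShift n q (-Real.pi) = -angleShift n q Real.pi := by
  rw [angleShift, angleShift, neg_div, Real.sin_neg, mul_neg, mul_neg, Real.arctan_neg]; ring

/-- Chord and torus arc subtend the same angle 2β at the axis. Hence the shift is well defined on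
the meridian circle. -/
lemma angleShift_pi {n q : ℕ} (hq : 2 ≤ q) (hn : 2 * q + 2 ≤ n) :
    angleShift n q Real.pi = 0 := by
  have h := halfAngle_mem hq hn
  rw [angleShift, Real.sin_pi_div_two, mul_one,
    Real.arctan_tan (by linarith [Real.pi_pos]) h.2, halfAngle]
  ring

lemma mul_cis_arctan {d x r : ℝ} (hd : 0 < d) (hr : 0 < r) (h : r ^ 2 = d ^ 2 + x ^ 2) :
    (d : ℂ) + x * Complex.I = r * cis (Real.arctan (x / d)) := by
  have hsq : √(1 + (x / d) ^ 2) = r / d := by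
    rw [show 1 + (x / d) ^ 2 = (r / d) ^ 2 by rw [div_pow, div_pow, h]; field_simp]
    exact Real.sqrt_sq (by positivity)
  apply Complex.ext
  · simp only [Complex.add_re, Complex.ofReal_re, Complex.re_ofReal_mul, Complex.I_re, cis_re,
      Real.cos_arctan, hsq]
    field_simp; ring
  · simp only [Complex.add_im, Complex.ofReal_im, Complex.im_ofReal_mul, Complex.I_im, cis_im,
      Real.sin_arctan, hsq]
    field_simp; ring

lemma stretch_corePoint {n q : ℕ} (hq : 2 ≤ q) (hn : 2 * q + 2 ≤ n) (i : ℤ) (u : ℝ) :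
    stretch (radialFactor (halfAngle n q)) (corePoint n q i u) =
      (((2 - Real.cos u : ℝ) : ℂ) * cis ((2 * i + 1) * halfAngle n q +
        Real.arctan (Real.tan (halfAngle n q) * Real.sin (u / 2))), Real.sin u) := by
  have hs := sin_halfAngle_pos hq hn
  have hc := cos_halfAngle_pos hq hn
  have hsq := sq_norm_corePoint n q i u
  have hcs := Real.sin_sq_add_cos_sq (halfAngle n q)
  set r := ‖(corePoint n q i u).1‖ with hr
  have hr0 : 0 ≤ r := norm_nonneg _
  have hrc : Real.cos (halfAngle n q) ≤ r := by
    apply le_of_sq_le_sq _ hr0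
    rw [hsq]; nlinarith [sq_nonneg (Real.sin (halfAngle n q) * Real.sin (u / 2))]
  have hr1 : r ≤ 1 := by
    apply le_of_sq_le_sq _ zero_le_one
    rw [hsq, mul_pow]
    nlinarith [Real.sin_sq_le_one (u / 2), sq_nonneg (Real.sin (halfAngle n q))]
  have hrp : 0 < r := hc.trans_le hrc
  have hfac : radialFactor (halfAngle n q) r * r = 2 - Real.cos u := by
    have hu : Real.cos u = 1 - 2 * Real.sin (u / 2) ^ 2 := by
      rw [← Real.cos_two_mul_eq_one_sub]; congr 1; ring
    rw [radialFactor_mul hrc hr1 hrp, hsq, hu]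
    field_simp; ring
  have htan : Real.tan (halfAngle n q) * Real.sin (u / 2)
      = Real.sin (halfAngle n q) * Real.sin (u / 2) / Real.cos (halfAngle n q) := by
    rw [Real.tan_eq_sin_div_cos]; ring
  refine Prod.ext ?_ rfl
  change (radialFactor (halfAngle n q) r : ℂ) * (corePoint n q i u).1 = _
  rw [corePoint, mul_cis_arctan hc hrp hsq, htan, cis_add, ← hfac]
  push_cast; ring

/-- The angle of the rotation that takes the stretched centre line to the torus knot. -/
noncomputable def twistAngle (n q : ℕ) (ρ z : ℝ) : ℝ :=
  angular (angleShift n q) ((2 - ρ : ℝ) + z * Complex.I)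

lemma twist_stretch_corePoint {n q : ℕ} (hq : 2 ≤ q) (hn : 2 * q + 2 ≤ n) (i : ℤ) {u : ℝ}
    (hu : u ∈ Set.Icc (-Real.pi) Real.pi) :
    twist (twistAngle n q) (stretch (radialFactor (halfAngle n q)) (corePoint n q i u)) =
      (((2 - Real.cos u : ℝ) : ℂ) * cis ((2 * i + 1) * halfAngle n q + q / n * u),
        Real.sin u) := by
  have hpi : angleShift n q (-Real.pi) = angleShift n q Real.pi := by
    rw [angleShift_neg_pi, angleShift_pi hq hn, neg_zero]
  have hα : twistAngle n q (2 - Real.cos u) (Real.sin u) = angleShift n q u := by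
    rw [twistAngle, sub_sub_cancel, ← angular_cis hpi hu.1 hu.2]
    congr 1
    apply Complex.ext
    · simp only [Complex.add_re, Complex.ofReal_re, Complex.re_ofReal_mul, Complex.I_re, cis_re,
        mul_zero, add_zero]
    · simp only [Complex.add_im, Complex.ofReal_im, Complex.im_ofReal_mul, Complex.I_im, cis_im,
        mul_one, zero_add]
  have h2 : 0 ≤ 2 - Real.cos u := by linarith [Real.cos_le_one u]
  rw [stretch_corePoint hq hn, twist]
  refine Prod.ext ?_ rfl
  simp only [norm_mul, norm_cis, mul_one, Complex.norm_real, Real.norm_eq_abs, abs_of_nonneg h2,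
    hα]
  rw [mul_assoc, ← cis_add, angleShift]
  congr 2; ring

lemma ambientIsotopic_core {n q : ℕ} (hq : 2 ≤ q) (hn : 2 * q + 2 ≤ n) (hne : Even n)
    (hco : Nat.Coprime n q) : AmbientIsotopic (layering hq hn hne hco).core (torusKnot n q) := by
  have hs := sin_halfAngle_pos hq hn
  have hc := cos_halfAngle_pos hq hn
  have hpi : angleShift n q (-Real.pi) = angleShift n q Real.pi := by
    rw [angleShift_neg_pi, angleShift_pi hq hn, neg_zero]
  have hcont : Continuous fun y : ℝ × ℝ => twistAngle n q y.1 y.2 :=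
    (continuous_angular (by unfold angleShift; fun_prop) hpi).comp (by fun_prop)
  have h := ambientIsotopic_trans
    (ambientIsotopic_stretch (continuous_radialFactor hc) one_pos le_rfl (one_le_radialFactor hc)
      (strictMonoOn_radialFactor hc hs) (layering hq hn hne hco).core)
    (ambientIsotopic_twist hcont _)
  convert h using 1
  rw [core_layering, torusKnot_eq (by omega)]
  ext x
  constructor
  · rintro ⟨i, u, hu, rfl⟩
    exact ⟨_, ⟨_, ⟨i, u, hu, rfl⟩, rfl⟩, twist_stretch_corePoint hq hn i hu⟩
  · rintro ⟨_, ⟨_, ⟨i, u, hu, rfl⟩, rfl⟩, rfl⟩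
    exact ⟨i, u, hu, (twist_stretch_corePoint hq hn i hu).symm⟩

end Core

end StarRibbon

theorem mainTheorem4 (q : ℕ) (hq : 3 ≤ q) (hodd : Odd q) (n : ℕ)
    (hn : n = 2 * q + 2 ∨ n = 2 * q + 4) :
    (∃ R : FoldedRibbon, R.Presents (torusKnot n q) ∧ R.FormsRegularPolygon n ∧
      R.ratio = n * Real.cot (Real.pi / n)) ∧
    ribbonlength (torusKnot n q) ≤ ENNReal.ofReal (n * Real.cot (Real.pi / n)) := by
  have hq2 : 2 ≤ q := by omega
  have hn2 : 2 * q + 2 ≤ n := by omega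
  have hne : Even n := by
    rcases hn with rfl | rfl
    · exact ⟨q + 1, by ring⟩
    · exact ⟨q + 2, by ring⟩
  -- A common divisor of `n` and `q` divides 2 or 4, and `q` is odd.
  have hco : Nat.Coprime n q := by
    have h2 : Nat.Coprime 2 q := Nat.coprime_two_left.2 hodd
    rcases hn with rfl | rfl
    · simpa [add_comm] using h2
    · have h4 : Nat.Coprime 4 q := h2.pow_left 2
      simpa [add_comm] using h4
  have hpres : (StarRibbon.ribbon hq2 hn2 hne).Presents (torusKnot n q) :=
    ⟨StarRibbon.layering hq2 hn2 hne hco, StarRibbon.ambientIsotopic_core hq2 hn2 hne hco⟩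
  refine ⟨⟨_, hpres, StarRibbon.ribbon_formsRegularPolygon hq2 hn2 hne hco,
    StarRibbon.ribbon_ratio hq2 hn2 hne⟩, ?_⟩
  rw [← StarRibbon.ribbon_ratio hq2 hn2 hne]
  exact iInf₂_le (f := fun (R : FoldedRibbon) (_ : R.Presents (torusKnot n q)) =>
    ENNReal.ofReal R.ratio) _ hpres
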